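/- **Setting.** Let $k:\mathcal X\times\mathcal X\to\mathbb R$ be a scalar (symmetric, positive semidefinite) kernel, $x_1,\dots,x_n\in\mathcal X$, $b_1,\dots,b_n\in\mathbb R^T$, and $f(\cdot)=\sum_{i=1}^n k(\cdot,x_i)\,b_i:\mathcal X\to\mathbb R^T$. Let $K=(k(x_i,x_j))_{i,j}\in\mathbb R^{n\times n}$, and let $B\in\mathbb R^{n\times T}$ be the matrix whose $i$-th row is $b_i^\top$. Let $\epsilon>0$, $\lambda>0$, $\mu\in[0,1]$, let $y_1,\dots,y_n\in\mathcal Y\subseteq\mathbb R^T$, and let $V:\mathcal Y\times\mathbb R^T\to[0,\infty)$ be a loss that is convex in its second argument. Write $S^T_{++}$ for the symmetric positive definite $T\times T$ matrices, $\|A\|_{\ell_1}=\sum_{t,s}|A_{ts}|$, $\langle X,Y\rangle=\sum_{t,s}X_{ts}Y_{ts}$ and $\|X\|_F^2=\langle X,X\rangle$. Put $$M=(B^\top KB+\epsilon I_T)^{-1/2},\qquad \sigma=\|M\|^2\ \text{(the squared largest eigenvalue of } M),\qquad L(A)=MAM,$$ $$G(A)=\mu\operatorname{tr}(A),\qquad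 H_1(A)=(1-\mu)\|A\|_{\ell_1},\qquad H_2(A)=\begin{cases}\operatorname{tr}(A^{-1}) & A\in S^T_{++}\\ +\infty&\text{otherwise.}\end{cases}$$ For $h:\mathbb R^{T\times T}\to\mathbb R\cup\{+\infty\}$ let $\operatorname{prox}_h(Y)=\operatorname{argmin}_X\{h(X)+\tfrac12\|X-Y\|_F^2\}$ and $h^*(D)=\sup_X\{\langle X,D\rangle-h(X)\}$. **Algorithm.** Starting from arbitrary $A_0,D_0\in S^T_{++}$, iterate for $t=0,1,2,\dots$ (without stopping) $$\begin{aligned}A_{t+1}&=\operatorname{prox}_{\frac{1-\mu}{\sigma}\|\cdot\|_{\ell_1}}\!\Big(A_t-\tfrac1\sigma\big(\mu I_T+MD_tM\big)\Big),\\ P_t&=D_t+\tfrac1\sigma M(2A_{t+1}-A_t)M,\\ D_{t+1}&=P_t-\tfrac1\sigma\operatorname{prox}_{\sigma H_2}(\sigma P_t).\end{aligned}$$ **Theorem (Convergence of Sparse Kernel MTL).** The sequence $A_t$ converges to a matrix $A_*\in S^T_{++}$ that is a global minimizer of both of the following problems: $$\min_{A\in S^T_{++}}\ \operatorname{tr}\big(A^{-1}(B^\top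 KB+\epsilon I_T)\big)+\mu\operatorname{tr}(A)+(1-\mu)\|A\|_{\ell_1},$$ $$\min_{A\in S^T_{++}}\ \frac1n\sum_{i=1}^nV(y_i,f(x_i))+\lambda\Big(\|f\|_{\mathcal H_A}^2+\epsilon\operatorname{tr}(A^{-1})+\mu\operatorname{tr}(A)+(1-\mu)\|A\|_{\ell_1}\Big)\quad(f\text{ fixed}),$$ where $\mathcal H_A$ is the reproducing kernel Hilbert space of $\mathbb R^T$-valued functions with kernel $(x,x')\mapsto k(x,x')A$. Furthermore, the sequence $D_t$ converges to a symmetric matrix $D_*$ that solves the Fenchel dual of the first problem, written as $\min_A G(A)+H_1(A)+H_2(L(A))$; that is, $D_*$ minimizes, with finite value, $$\min_{D\in\mathbb R^{T\times T}}\ (G+H_1)^*(-L^*D)+H_2^*(D),\qquad L^*D=MDM.$$ -/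

import Mathlib

open Filter Topology

noncomputable section

namespace SKMTL

/-- Real `T × T` matrices, the ambient space of the structure matrix and of the dual variable. -/
abbrev Mat (T : ℕ) := Matrix (Fin T) (Fin T) ℝ

/-- `ℝ^T` with its Euclidean inner product. -/
abbrev Vec (T : ℕ) := EuclideanSpace ℝ (Fin T)

/-- `a` is a global minimizer, with finite value, of the extended-real-valued `F` over `s`. -/
def IsGlobalMinimizer {α : Type*} (F : α → EReal) (s : Set α) (a : α) : Prop :=
  a ∈ s ∧ F a ≠ ⊤ ∧ ∀ b ∈ s, F a ≤ F b

/-! ### Matrix functionals -/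

/-- The entrywise norm `‖A‖_{ℓ₁} = ∑_{t,s} |A_{ts}|`. -/
def l1Norm {T : ℕ} (A : Mat T) : ℝ := ∑ t, ∑ s, |A t s|

/-- The Frobenius inner product `⟨X, Y⟩ = ∑_{t,s} X_{ts} Y_{ts}`. -/
def frobInner {T : ℕ} (X Y : Mat T) : ℝ := ∑ t, ∑ s, X t s * Y t s

/-- The positive semidefinite matrix `M = Q^{-1/2}`, for `Q` positive definite. -/
def invSqrt {T : ℕ} (Q : Mat T) : Mat T :=
  open scoped MatrixOrder in CFC.sqrt Q⁻¹

/-- The squared spectral norm `σ = ‖M‖²`, which for `M` positive semidefinite is its squared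
maximal eigenvalue. -/
def specNormSq {T : ℕ} (M : Mat T) : ℝ :=
  ‖Matrix.toEuclideanCLM (n := Fin T) (𝕜 := ℝ) M‖ ^ 2

/-! ### Proximal maps and convex conjugates (for the Frobenius inner product) -/

/-- `X` attains the minimum of `h(X) + ½‖X - Y‖²_F`. -/
def IsProxPoint {T : ℕ} (h : Mat T → EReal) (Y X : Mat T) : Prop :=
  IsGlobalMinimizer (fun Z => h Z + ((1 / 2 * frobInner (Z - Y) (Z - Y) : ℝ) : EReal)) Set.univ X

/-- The proximity operator `prox_h(Y) = argmin_X { h(X) + ½‖X - Y‖²_F }`. -/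
def prox {T : ℕ} (h : Mat T → EReal) (Y : Mat T) : Mat T :=
  Classical.epsilon (IsProxPoint h Y)

/-- The Fenchel conjugate `h*(D) = sup_X { ⟨X, D⟩ - h(X) }`. -/
def fenchelConj {T : ℕ} (h : Mat T → EReal) (D : Mat T) : EReal :=
  ⨆ X : Mat T, (((frobInner X D : ℝ) : EReal) - h X)

/-! ### The structure problem for fixed coefficients -/

/-- `Q = Bᵀ K B + ε I_T`. -/
def taskCov {n T : ℕ} (K : Matrix (Fin n) (Fin n) ℝ) (B : Matrix (Fin n) (Fin T) ℝ) (ε : ℝ) :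
    Mat T :=
  B.transpose * K * B + ε • (1 : Mat T)

/-- `tr(A⁻¹ (Bᵀ K B + ε I_T)) + μ tr(A) + (1 - μ) ‖A‖_{ℓ₁}`; to be minimized over positive
definite `A`. -/
def structureObjective {n T : ℕ} (K : Matrix (Fin n) (Fin n) ℝ) (B : Matrix (Fin n) (Fin T) ℝ)
    (ε μ : ℝ) (A : Mat T) : EReal :=
  (((A⁻¹ * taskCov K B ε).trace + μ * A.trace + (1 - μ) * l1Norm A : ℝ) : EReal)

/-- `G(A) + H₁(A) = μ tr(A) + (1 - μ) ‖A‖_{ℓ₁}`. -/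
def GH₁ {T : ℕ} (μ : ℝ) (A : Mat T) : EReal :=
  ((μ * A.trace + (1 - μ) * l1Norm A : ℝ) : EReal)

open Classical in
/-- `H₂(A) = tr(A⁻¹)` for positive definite `A`, and `+∞` otherwise. -/
def H₂ {T : ℕ} (A : Mat T) : EReal :=
  if A.PosDef then ((A⁻¹.trace : ℝ) : EReal) else ⊤

/-- The operator `L(A) = M A M`. It is its own adjoint when `M` is symmetric. -/
def L {T : ℕ} (M A : Mat T) : Mat T := M * A * M

/-- The objective `(G + H₁)*(-L* D) + H₂*(D)` of the Fenchel dual of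
`min_A G(A) + H₁(A) + H₂(L A)`; to be minimized over `D`. Here `M = Q^{-1/2}`, so that
`L* = L` and `H₂(L A) = tr(A⁻¹ Q)` on positive definite matrices `A`. -/
def dualObjective {n T : ℕ} (K : Matrix (Fin n) (Fin n) ℝ) (B : Matrix (Fin n) (Fin T) ℝ)
    (ε μ : ℝ) (D : Mat T) : EReal :=
  fenchelConj (GH₁ μ) (-(L (invSqrt (taskCov K B ε)) D)) + fenchelConj H₂ D

/-! ### The algorithm -/

/-- One iteration of the primal-dual splitting, from `(A_i, D_i)` to `(A_{i+1}, D_{i+1})`: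
* `A_{i+1} = prox_{((1-μ)/σ) ‖·‖_{ℓ₁}} (A_i - (1/σ) (μ I + M D_i M))`;
* `P = D_i + (1/σ) M (2 A_{i+1} - A_i) M`;
* `D_{i+1} = P - (1/σ) prox_{σ H₂} (σ P)`,

with `M = (Bᵀ K B + ε I)^{-1/2}` and `σ = ‖M‖²`. -/
def step {n T : ℕ} (K : Matrix (Fin n) (Fin n) ℝ) (B : Matrix (Fin n) (Fin T) ℝ) (ε μ : ℝ)
    (p : Mat T × Mat T) : Mat T × Mat T :=
  let M : Mat T := invSqrt (taskCov K B ε)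
  let σ : ℝ := specNormSq M
  let A' : Mat T :=
    prox (fun X => (((1 - μ) / σ * l1Norm X : ℝ) : EReal))
      (p.1 - (1 / σ) • (μ • (1 : Mat T) + M * p.2 * M))
  let P : Mat T := p.2 + (1 / σ) • (M * ((2 : ℝ) • A' - p.1) * M)
  (A', P - (1 / σ) • prox (fun X => (σ : EReal) * H₂ X) (σ • P))

/-! ### The joint learning problem -/

/-- The separable matrix-valued kernel `Γ(x, x') = k(x, x') A`. -/
def sepKernel {𝒳 : Type*} {T : ℕ} (k : 𝒳 → 𝒳 → ℝ) (A : Mat T) :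
    Matrix 𝒳 𝒳 (Vec T →L[ℝ] Vec T) :=
  Matrix.of fun x x' => k x x' • Matrix.toEuclideanCLM (n := Fin T) (𝕜 := ℝ) A

open Classical in
/-- `‖f‖²_ℋ` in the reproducing kernel Hilbert space `ℋ` of `ℝ^T`-valued functions with kernel
`Γ`; it is `+∞` if `f ∉ ℋ` (or if `Γ` is not a kernel, that is, not positive semidefinite). -/
def rkhsNormSq {𝒳 : Type*} {T : ℕ} (Γ : Matrix 𝒳 𝒳 (Vec T →L[ℝ] Vec T)) (f : 𝒳 → Vec T) :
    EReal :=
  if hΓ : Γ.PosSemidef then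
    haveI : Fact Γ.PosSemidef := ⟨hΓ⟩
    ⨅ (g : RKHS.OfKernel Γ) (_ : (g : 𝒳 → Vec T) = f), ((‖g‖ ^ 2 : ℝ) : EReal)
  else ⊤

/-- The objective
`(1/n) ∑ᵢ V(yᵢ, f(xᵢ)) + lam (‖f‖²_ℋ + ε tr(A⁻¹) + μ tr(A) + (1 - μ) ‖A‖_{ℓ₁})`, where `ℋ` is
the reproducing kernel Hilbert space of the kernel `k A`. -/
def jointObjective {𝒳 : Type*} {n T : ℕ} {𝒴 : Set (Vec T)} (k : 𝒳 → 𝒳 → ℝ)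
    (V : 𝒴 → Vec T → ℝ) (lam ε μ : ℝ) (x : Fin n → 𝒳) (y : Fin n → 𝒴)
    (f : 𝒳 → Vec T) (A : Mat T) : EReal :=
  ((1 / (n : ℝ) * ∑ i, V (y i) (f (x i)) : ℝ) : EReal) +
    (lam : EReal) * (rkhsNormSq (sepKernel k A) f +
      ((ε * A⁻¹.trace + μ * A.trace + (1 - μ) * l1Norm A : ℝ) : EReal))

end SKMTL

end

/-! Since `G` is linear, its gradient step is a constant shift inside the primal prox, and the
algorithm becomes a primal-dual splitting with two firmly nonexpansive maps and the operator `S =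
L/σ`. As `‖L‖ ≤ σ`, one has `‖S‖ ≤ 1`: the boundary of the step size condition, where the
preconditioner with blocks `I, -S, -S, I` is only positive semidefinite. The iterates are Fejér
monotone in the resulting seminorm, which controls `a - S d` and `d - S a` but not `a` and `d`. This
suffices, because the next iterate depends continuously on these two combinations alone
(`exists_tendsto_primalDual`).

Fixed points of the iteration are exactly the saddle points (`isSaddle_iff_fixedPoint`). One exists
(`exists_isSaddle`): the primal objective has compact sublevel sets in the positive definite cone,
since its trace part bounds the entries and `tr((L A)⁻¹)` bounds the determinant away from zero; the
dual variable is the gradient `-(L A)⁻²`. Saddle points solve the primal and the dual problem by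
Fenchel-Young equality.

For fixed `f`, `‖f‖²` in the space of `k A` equals `tr(A⁻¹ Bᵀ K B)` (`rkhsNormSq_sepKernel`), so the
two primal objectives differ by an increasing affine map. -/

noncomputable section

namespace SKMTL

/-! ### Primal-dual iterations of firmly nonexpansive maps -/

section PrimalDual

open scoped RealInnerProductSpace

variable {E : Type*} [NormedAddCommGroup E] [InnerProductSpace ℝ E]

/-- A map `p` with `‖p u - p v‖² ≤ ⟪p u - p v, u - v⟫`. -/
def FirmlyNonexpansive (p : E → E) : Prop :=
  ∀ u v, ‖p u - p v‖ ^ 2 ≤ ⟪p u - p v, u - v⟫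

theorem FirmlyNonexpansive.continuous {p : E → E} (hp : FirmlyNonexpansive p) :
    Continuous p := by
  refine (LipschitzWith.of_dist_le_mul (K := 1) fun u v => ?_).continuous
  rw [dist_eq_norm, dist_eq_norm, NNReal.coe_one, one_mul]
  have h1 := hp u v
  have h2 := real_inner_le_norm (p u - p v) (u - v)
  by_contra! h
  nlinarith [norm_nonneg (p u - p v), norm_nonneg (u - v)]

/-- The quadratic form `‖a‖² + ‖d‖² - 2 ⟪S a, d⟫` in which primal-dual iterations are Fejér
monotone. -/
def pdForm (S : E →L[ℝ] E) (a d : E) : ℝ := ‖a‖ ^ 2 + ‖d‖ ^ 2 - 2 * ⟪S a, d⟫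

theorem continuous_pdForm (S : E →L[ℝ] E) : Continuous fun z : E × E => pdForm S z.1 z.2 := by
  unfold pdForm
  fun_prop

theorem pdForm_zero (S : E →L[ℝ] E) : pdForm S 0 0 = 0 := by simp [pdForm]

variable {S : E →L[ℝ] E}

/-- Expanding each square and using `‖S d‖ ≤ ‖d‖`, `‖S a‖ ≤ ‖a‖` bounds it by the form. If `‖S‖ = 1`
the form may degenerate, and these combinations are all it controls. -/
theorem sq_add_sq_le_pdForm (hS : ∀ x y, ⟪S x, y⟫ = ⟪x, S y⟫) (hS₁ : ∀ x, ‖S x‖ ≤ ‖x‖)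
    (a d : E) : ‖a - S d‖ ^ 2 + ‖d - S a‖ ^ 2 ≤ 2 * pdForm S a d := by
  have h1 : ‖S a‖ ^ 2 ≤ ‖a‖ ^ 2 := by gcongr; exact hS₁ a
  have h2 : ‖S d‖ ^ 2 ≤ ‖d‖ ^ 2 := by gcongr; exact hS₁ d
  have h3 := hS a d
  have h4 := real_inner_comm d (S a)
  rw [pdForm, norm_sub_sq_real, norm_sub_sq_real]
  linarith

theorem pdForm_nonneg (hS : ∀ x y, ⟪S x, y⟫ = ⟪x, S y⟫) (hS₁ : ∀ x, ‖S x‖ ≤ ‖x‖)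
    (a d : E) : 0 ≤ pdForm S a d := by
  have := sq_add_sq_le_pdForm hS hS₁ a d
  nlinarith [sq_nonneg ‖a - S d‖, sq_nonneg ‖d - S a‖]

/-- Adding the two firm inequalities gives `Q(z') ≤ ⟨z', z⟩_Q` for the differences `z`, `z'` of old
and new pairs; the extrapolation `2 a' - a` is what makes the cross terms those of the symmetric
form. Polarization finishes. -/
theorem pdForm_step {p q : E → E} (hp : FirmlyNonexpansive p) (hq : FirmlyNonexpansive q)
    (hS : ∀ x y, ⟪S x, y⟫ = ⟪x, S y⟫) {a d a' d' b e b' e' : E}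
    (ha : a' = p (a - S d)) (hd : d' = q (d + S ((2 : ℝ) • a' - a)))
    (hb : b' = p (b - S e)) (he : e' = q (e + S ((2 : ℝ) • b' - b))) :
    pdForm S (a' - b') (d' - e') + pdForm S ((a' - a) - (b' - b)) ((d' - d) - (e' - e)) ≤
      pdForm S (a - b) (d - e) := by
  have h1 := hp (a - S d) (b - S e)
  have h2 := hq (d + S ((2 : ℝ) • a' - a)) (e + S ((2 : ℝ) • b' - b))
  rw [← ha, ← hb] at h1
  rw [← hd, ← he] at h2
  obtain ⟨x, hx⟩ : ∃ x, x = a - b := ⟨_, rfl⟩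
  obtain ⟨y, hy⟩ : ∃ y, y = d - e := ⟨_, rfl⟩
  obtain ⟨x', hx'⟩ : ∃ x', x' = a' - b' := ⟨_, rfl⟩
  obtain ⟨y', hy'⟩ : ∃ y', y' = d' - e' := ⟨_, rfl⟩
  have e1 : a - S d - (b - S e) = x - S y := by rw [hx, hy, map_sub]; abel
  have e2 : d + S ((2 : ℝ) • a' - a) - (e + S ((2 : ℝ) • b' - b)) = y + (2 : ℝ) • S x' - S x := by
    simp only [hx, hy, hx', map_sub, map_smul, smul_sub]; abel
  have e3 : (a' - a) - (b' - b) = x' - x := by rw [hx, hx']; abel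
  have e4 : (d' - d) - (e' - e) = y' - y := by rw [hy, hy']; abel
  rw [e1, ← hx'] at h1
  rw [e2, ← hy'] at h2
  rw [e3, e4, ← hx, ← hy, ← hx', ← hy']
  simp only [pdForm, norm_sub_sq_real, map_sub, inner_sub_left, inner_sub_right, inner_add_right,
    inner_smul_right] at *
  have := hS x' y
  have := real_inner_comm (S x') y'
  have := real_inner_comm (S x) y'
  linarith

/-- Convergence of the primal-dual iteration with firmly nonexpansive maps `p` and `q`, in the
boundary case `‖S‖ ≤ 1` of the step size condition. -/
theorem exists_tendsto_primalDual [FiniteDimensional ℝ E] {p q : E → E}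
    (hp : FirmlyNonexpansive p) (hq : FirmlyNonexpansive q)
    (hS : ∀ x y, ⟪S x, y⟫ = ⟪x, S y⟫) (hS₁ : ∀ x, ‖S x‖ ≤ ‖x‖) {a d : ℕ → E}
    (ha : ∀ i, a (i + 1) = p (a i - S (d i)))
    (hd : ∀ i, d (i + 1) = q (d i + S ((2 : ℝ) • a (i + 1) - a i)))
    {a₀ d₀ : E} (ha₀ : a₀ = p (a₀ - S d₀)) (hd₀ : d₀ = q (d₀ + S a₀)) :
    ∃ a' d', Tendsto a atTop (𝓝 a') ∧ Tendsto d atTop (𝓝 d') ∧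
      a' = p (a' - S d') ∧ d' = q (d' + S a') := by
  have two_sub (x : E) : (2 : ℝ) • x - x = x := by rw [two_smul]; abel
  have fejer {b e : E} (hb : b = p (b - S e)) (he : e = q (e + S b)) (i : ℕ) :
      pdForm S (a (i + 1) - b) (d (i + 1) - e) +
        pdForm S (a (i + 1) - a i) (d (i + 1) - d i) ≤ pdForm S (a i - b) (d i - e) := by
    have := pdForm_step (b := b) (e := e) (b' := b) (e' := e) hp hq hS (ha i) (hd i) hb
      (by rw [two_sub]; exact he)
    rwa [sub_self, sub_self, sub_zero, sub_zero] at this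
  have anti {b e : E} (hb : b = p (b - S e)) (he : e = q (e + S b)) :
      Antitone fun i => pdForm S (a i - b) (d i - e) :=
    antitone_nat_of_succ_le fun i => by
      linarith [fejer hb he i, pdForm_nonneg hS hS₁ (a (i + 1) - a i) (d (i + 1) - d i)]
  have lim_incr : Tendsto (fun i => pdForm S (a (i + 1) - a i) (d (i + 1) - d i)) atTop (𝓝 0) := by
    have hbdd : BddBelow (Set.range fun i => pdForm S (a i - a₀) (d i - d₀)) :=
      ⟨0, by rintro _ ⟨i, rfl⟩; exact pdForm_nonneg hS hS₁ _ _⟩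
    have h1 := tendsto_atTop_ciInf (anti ha₀ hd₀) hbdd
    have h2 := h1.sub ((tendsto_add_atTop_iff_nat 1).2 h1)
    rw [sub_self] at h2
    exact squeeze_zero (fun i => pdForm_nonneg hS hS₁ _ _)
      (fun i => by linarith [fejer ha₀ hd₀ i]) h2
  have lim_of_form {x y : ℕ → E} (h : Tendsto (fun i => pdForm S (x i) (y i)) atTop (𝓝 0)) :
      Tendsto (fun i => x i - S (y i)) atTop (𝓝 0) ∧
        Tendsto (fun i => y i - S (x i)) atTop (𝓝 0) := by
    have h2 : Tendsto (fun i => 2 * pdForm S (x i) (y i)) atTop (𝓝 0) := by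
      simpa using h.const_mul 2
    have key {z : ℕ → E} (hz : ∀ i, ‖z i‖ ^ 2 ≤ 2 * pdForm S (x i) (y i)) :
        Tendsto z atTop (𝓝 0) := by
      have h3 := (squeeze_zero (fun i => sq_nonneg _) hz h2).sqrt
      simp only [Real.sqrt_sq (norm_nonneg _), Real.sqrt_zero] at h3
      exact tendsto_zero_iff_norm_tendsto_zero.2 h3
    refine ⟨key fun i => ?_, key fun i => ?_⟩
    · linarith [sq_add_sq_le_pdForm hS hS₁ (x i) (y i), sq_nonneg ‖y i - S (x i)‖]
    · linarith [sq_add_sq_le_pdForm hS hS₁ (x i) (y i), sq_nonneg ‖x i - S (y i)‖]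
  have ha' (i : ℕ) : a (i + 1) = p (a i - S (d i)) := ha i
  -- Regrouped so that the new pair is a function of `a - S d` and `d - S a` only.
  have hd' (i : ℕ) : d (i + 1) = q ((d i - S (a i)) + (2 : ℝ) • S (a (i + 1))) := by
    rw [hd i, map_sub, map_smul]; congr 1; abel
  -- a cluster point of the preconditioned iterates
  have hbound : ∀ i, (a i - S (d i), d i - S (a i)) ∈
      Metric.closedBall (a₀ - S d₀, d₀ - S a₀)
        (2 * pdForm S (a 0 - a₀) (d 0 - d₀) + 1) := fun i => by
    have h1 := sq_add_sq_le_pdForm hS hS₁ (a i - a₀) (d i - d₀)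
    have h2 : pdForm S (a i - a₀) (d i - d₀) ≤ pdForm S (a 0 - a₀) (d 0 - d₀) :=
      anti ha₀ hd₀ (Nat.zero_le i)
    have e1 : a i - S (d i) - (a₀ - S d₀) = a i - a₀ - S (d i - d₀) := by rw [map_sub]; abel
    have e2 : d i - S (a i) - (d₀ - S a₀) = d i - d₀ - S (a i - a₀) := by rw [map_sub]; abel
    rw [Metric.mem_closedBall, Prod.dist_eq, dist_eq_norm, dist_eq_norm, e1, e2]
    refine max_le ?_ ?_
    · nlinarith [sq_nonneg (‖a i - a₀ - S (d i - d₀)‖ - 1), sq_nonneg ‖d i - d₀ - S (a i - a₀)‖]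
    · nlinarith [sq_nonneg (‖d i - d₀ - S (a i - a₀)‖ - 1), sq_nonneg ‖a i - a₀ - S (d i - d₀)‖]
  obtain ⟨⟨u, w⟩, -, φ, hφ, hlim⟩ :=
    (isCompact_closedBall _ _).tendsto_subseq hbound
  have hu : Tendsto (fun k => a (φ k) - S (d (φ k))) atTop (𝓝 u) :=
    (continuous_fst.tendsto _).comp hlim
  have hw : Tendsto (fun k => d (φ k) - S (a (φ k))) atTop (𝓝 w) :=
    (continuous_snd.tendsto _).comp hlim
  have cp := hp.continuous
  have cq := hq.continuous
  have hA : Tendsto (fun k => a (φ k + 1)) atTop (𝓝 (p u)) := by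
    simp only [ha']
    exact (cp.tendsto u).comp hu
  have hD : Tendsto (fun k => d (φ k + 1)) atTop (𝓝 (q (w + (2 : ℝ) • S (p u)))) := by
    simp only [hd']
    exact (cq.tendsto _).comp (hw.add (((S.continuous.tendsto _).comp hA).const_smul _))
  obtain ⟨i1, i2⟩ := lim_of_form lim_incr
  generalize hb : p u = b at *
  generalize he : q (w + (2 : ℝ) • S b) = e at *
  -- The increments vanish in the seminorm, so the preconditioned iterates at `φ k` and `φ k + 1`
  -- share their limit; hence `(b, e)` is a fixed point.
  have hub : b - S e = u := by
    refine tendsto_nhds_unique (hA.sub ((S.continuous.tendsto _).comp hD)) ?_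
    have := (i1.comp hφ.tendsto_atTop).add hu
    rw [zero_add] at this
    refine this.congr fun k => ?_
    simp only [Function.comp, map_sub]; abel
  have hwe : e - S b = w := by
    refine tendsto_nhds_unique (hD.sub ((S.continuous.tendsto _).comp hA)) ?_
    have := (i2.comp hφ.tendsto_atTop).add hw
    rw [zero_add] at this
    refine this.congr fun k => ?_
    simp only [Function.comp, map_sub]; abel
  have fb : b = p (b - S e) := by rw [hub, hb]
  have fe : e = q (e + S b) := by
    conv_lhs => rw [← he, ← hwe]
    congr 1; rw [two_smul]; abel
  -- the distance to the cluster point decreases, and tends to zero along a subsequence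
  have hform : Tendsto (fun i => pdForm S (a i - b) (d i - e)) atTop (𝓝 0) := by
    have hsub : Tendsto (fun k => pdForm S (a (φ k + 1) - b) (d (φ k + 1) - e)) atTop (𝓝 0) := by
      have := ((continuous_pdForm S).tendsto (0, 0)).comp
        ((show Tendsto (fun k => a (φ k + 1) - b) atTop (𝓝 0) by
          simpa using hA.sub_const b).prodMk_nhds
        (show Tendsto (fun k => d (φ k + 1) - e) atTop (𝓝 0) by simpa using hD.sub_const e))
      rwa [pdForm_zero] at this
    have hbdd : BddBelow (Set.range fun i => pdForm S (a i - b) (d i - e)) :=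
      ⟨0, by rintro _ ⟨i, rfl⟩; exact pdForm_nonneg hS hS₁ _ _⟩
    have h1 := tendsto_atTop_ciInf (anti fb fe) hbdd
    have h2 := h1.comp ((tendsto_add_atTop_nat 1).comp hφ.tendsto_atTop)
    rwa [tendsto_nhds_unique h2 hsub] at h1
  obtain ⟨j1, j2⟩ := lim_of_form hform
  have lu : Tendsto (fun i => a i - S (d i)) atTop (𝓝 u) := by
    have := j1.add_const u
    rw [zero_add] at this
    refine this.congr fun i => ?_
    rw [← hub, map_sub]; abel
  have lw : Tendsto (fun i => d i - S (a i)) atTop (𝓝 w) := by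
    have := j2.add_const w
    rw [zero_add] at this
    refine this.congr fun i => ?_
    rw [← hwe, map_sub]; abel
  -- So far only the preconditioned variables converge in full; one more application of the
  -- continuous `p` and `q` gives convergence of `a` and `d`.
  have la : Tendsto (fun i => a (i + 1)) atTop (𝓝 b) := by
    simp only [ha']
    exact hb ▸ (cp.tendsto u).comp lu
  have ld : Tendsto (fun i => d (i + 1)) atTop (𝓝 e) := by
    simp only [hd']
    exact he ▸ (cq.tendsto _).comp (lw.add (((S.continuous.tendsto _).comp la).const_smul _))
  exact ⟨b, e, (tendsto_add_atTop_iff_nat 1).1 la, (tendsto_add_atTop_iff_nat 1).1 ld, fb, fe⟩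

end PrimalDual

open Matrix

variable {T : ℕ}

/-! ### The Frobenius inner product -/

theorem frobInner_eq_trace (X Y : Mat T) : frobInner X Y = (Xᵀ * Y).trace := by
  simp only [frobInner, trace, diag_apply, mul_apply, transpose_apply]
  exact Finset.sum_comm

theorem frobInner_comm (X Y : Mat T) : frobInner X Y = frobInner Y X := by
  simp only [frobInner, mul_comm]

theorem frobInner_add_left (X Y Z : Mat T) :
    frobInner (X + Y) Z = frobInner X Z + frobInner Y Z := by
  simp only [frobInner, Matrix.add_apply, add_mul, Finset.sum_add_distrib]

theorem frobInner_smul_left (c : ℝ) (X Y : Mat T) :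
    frobInner (c • X) Y = c * frobInner X Y := by
  simp only [frobInner, Matrix.smul_apply, smul_eq_mul, mul_assoc, Finset.mul_sum]

theorem frobInner_neg_left (X Y : Mat T) : frobInner (-X) Y = -frobInner X Y := by
  simp only [frobInner, Matrix.neg_apply, neg_mul, Finset.sum_neg_distrib]

theorem frobInner_sub_left (X Y Z : Mat T) :
    frobInner (X - Y) Z = frobInner X Z - frobInner Y Z := by
  rw [sub_eq_add_neg, frobInner_add_left, frobInner_neg_left, sub_eq_add_neg]

theorem frobInner_add_right (X Y Z : Mat T) :
    frobInner X (Y + Z) = frobInner X Y + frobInner X Z := by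
  simp only [frobInner_comm X, frobInner_add_left]

theorem frobInner_smul_right (c : ℝ) (X Y : Mat T) :
    frobInner X (c • Y) = c * frobInner X Y := by
  simp only [frobInner_comm X, frobInner_smul_left]

theorem frobInner_neg_right (X Y : Mat T) : frobInner X (-Y) = -frobInner X Y := by
  simp only [frobInner_comm X, frobInner_neg_left]

theorem frobInner_sub_right (X Y Z : Mat T) :
    frobInner X (Y - Z) = frobInner X Y - frobInner X Z := by
  simp only [frobInner_comm X, frobInner_sub_left]

theorem frobInner_self_nonneg (X : Mat T) : 0 ≤ frobInner X X :=
  Finset.sum_nonneg fun _ _ => Finset.sum_nonneg fun _ _ => mul_self_nonneg _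

theorem sq_apply_le_frobInner (X : Mat T) (i j : Fin T) : X i j ^ 2 ≤ frobInner X X := by
  have h1 : X i j * X i j ≤ ∑ s, X i s * X i s :=
    Finset.single_le_sum (f := fun s => X i s * X i s) (fun s _ => mul_self_nonneg _)
      (Finset.mem_univ j)
  have h2 : ∑ s, X i s * X i s ≤ frobInner X X :=
    Finset.single_le_sum (f := fun t => ∑ s, X t s * X t s)
      (fun t _ => Finset.sum_nonneg fun s _ => mul_self_nonneg _) (Finset.mem_univ i)
  nlinarith

theorem eq_zero_of_frobInner_self_nonpos {X : Mat T} (h : frobInner X X ≤ 0) : X = 0 := by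
  ext i j
  have := sq_apply_le_frobInner X i j
  exact pow_eq_zero_iff two_ne_zero |>.1 (le_antisymm (this.trans h) (sq_nonneg _))

theorem frobInner_transpose (X Y : Mat T) : frobInner Xᵀ Yᵀ = frobInner X Y := by
  simp only [frobInner, transpose_apply]
  exact Finset.sum_comm

theorem continuous_frobInner : Continuous fun p : Mat T × Mat T => frobInner p.1 p.2 := by
  unfold frobInner
  fun_prop

/-! ### The operator `L` and its norm -/

theorem frobInner_mul_left_le (M X : Mat T) :
    frobInner (M * X) (M * X) ≤ specNormSq M * frobInner X X := by
  have col (s : Fin T) : ∑ t, (M * X) t s * (M * X) t s ≤ specNormSq M * ∑ t, X t s * X t s := by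
    have h := (toEuclideanCLM (n := Fin T) (𝕜 := ℝ) M).le_opNorm (WithLp.toLp 2 fun t => X t s)
    have h2 := pow_le_pow_left₀ (norm_nonneg _) h 2
    rw [mul_pow, toEuclideanCLM_toLp, EuclideanSpace.real_norm_sq_eq,
      EuclideanSpace.real_norm_sq_eq] at h2
    simpa [specNormSq, sq, mulVec, dotProduct, mul_apply] using h2
  rw [frobInner, frobInner, Finset.sum_comm, Finset.sum_comm (f := fun t s => X t s * X t s),
    Finset.mul_sum]
  exact Finset.sum_le_sum fun s _ => col s

theorem specNormSq_nonneg (M : Mat T) : 0 ≤ specNormSq M := sq_nonneg _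

theorem specNormSq_pos [Nonempty (Fin T)] {M : Mat T} (hM : IsUnit M) : 0 < specNormSq M := by
  refine pow_pos (norm_pos_iff.2 fun h => ?_) 2
  have : M = 0 := by simpa using h
  exact not_isUnit_zero (this ▸ hM)

theorem frobInner_L_left {M : Mat T} (hM : M.IsSymm) (X Y : Mat T) :
    frobInner (L M X) Y = frobInner X (L M Y) := by
  rw [frobInner_eq_trace, frobInner_eq_trace, L, L, transpose_mul, transpose_mul, hM.eq,
    Matrix.mul_assoc, trace_mul_comm]
  simp only [Matrix.mul_assoc]

/-- Left and right multiplication by `M` each cost a factor `specNormSq M`, the latter by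
transposition. Thus `L/σ` is nonexpansive. -/
theorem frobInner_L_self_le {M : Mat T} (hM : M.IsSymm) (X : Mat T) :
    frobInner (L M X) (L M X) ≤ specNormSq M ^ 2 * frobInner X X := by
  have h1 : frobInner (L M X) (L M X) ≤ specNormSq M * frobInner (X * M) (X * M) := by
    rw [L, Matrix.mul_assoc]; exact frobInner_mul_left_le _ _
  have h2 : frobInner (X * M) (X * M) ≤ specNormSq M * frobInner X X := by
    rw [← frobInner_transpose (X * M), ← frobInner_transpose X, transpose_mul, hM.eq]
    exact frobInner_mul_left_le _ _
  nlinarith [specNormSq_nonneg M]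

theorem L_add (M X Y : Mat T) : L M (X + Y) = L M X + L M Y := by
  simp only [L, Matrix.mul_add, Matrix.add_mul]

theorem L_sub (M X Y : Mat T) : L M (X - Y) = L M X - L M Y := by
  simp only [L, Matrix.mul_sub, Matrix.sub_mul]

theorem L_smul (M : Mat T) (c : ℝ) (X : Mat T) : L M (c • X) = c • L M X := by
  simp only [L, Matrix.mul_smul, Matrix.smul_mul]

theorem continuous_L (M : Mat T) : Continuous (L M) := by
  unfold L
  fun_prop

theorem L_isSymm {M : Mat T} (hM : M.IsSymm) {X : Mat T} (hX : X.IsSymm) : (L M X).IsSymm := by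
  rw [Matrix.IsSymm, L, transpose_mul, transpose_mul, hM.eq, hX.eq, Matrix.mul_assoc]

/-- `Mat T` with the Frobenius norm and inner product. -/
abbrev frobNormed : NormedAddCommGroup (Mat T) := Matrix.frobeniusNormedAddCommGroup

/-- The inner product space structure of the Frobenius inner product. -/
abbrev frobInnerSpace : @InnerProductSpace ℝ (Mat T) _ frobNormed.toSeminormedAddCommGroup :=
  letI : NormedAddCommGroup (Mat T) := frobNormed
  { Matrix.frobeniusNormedSpace (R := ℝ) with
    inner := frobInner
    norm_sq_eq_re_inner := fun X => by
      have h : ‖X‖ = Real.sqrt (frobInner X X) := by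
        rw [frobenius_norm_def, Real.sqrt_eq_rpow]
        simp [frobInner, sq]
      rw [h, Real.sq_sqrt (frobInner_self_nonneg X)]
      rfl
    conj_inner_symm := fun X Y => frobInner_comm Y X
    add_left := frobInner_add_left
    smul_left := fun X Y c => frobInner_smul_left c X Y }

/-- `exists_tendsto_primalDual` for matrices. -/
theorem exists_tendsto_primalDual_frobInner {p q : Mat T → Mat T}
    (hp : ∀ X Y, frobInner (p X - p Y) (p X - p Y) ≤ frobInner (p X - p Y) (X - Y))
    (hq : ∀ X Y, frobInner (q X - q Y) (q X - q Y) ≤ frobInner (q X - q Y) (X - Y))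
    (S : Mat T →ₗ[ℝ] Mat T) (hS : ∀ X Y, frobInner (S X) Y = frobInner X (S Y))
    (hS₁ : ∀ X, frobInner (S X) (S X) ≤ frobInner X X) {a d : ℕ → Mat T}
    (ha : ∀ i, a (i + 1) = p (a i - S (d i)))
    (hd : ∀ i, d (i + 1) = q (d i + S ((2 : ℝ) • a (i + 1) - a i)))
    {a₀ d₀ : Mat T} (ha₀ : a₀ = p (a₀ - S d₀)) (hd₀ : d₀ = q (d₀ + S a₀)) :
    ∃ a' d', Tendsto a atTop (𝓝 a') ∧ Tendsto d atTop (𝓝 d') ∧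
      a' = p (a' - S d') ∧ d' = q (d' + S a') := by
  let _ : NormedAddCommGroup (Mat T) := frobNormed
  let _ : InnerProductSpace ℝ (Mat T) := frobInnerSpace
  have norm_sq (X : Mat T) : ‖X‖ ^ 2 = frobInner X X := InnerProductSpace.norm_sq_eq_re_inner (𝕜 := ℝ) X
  refine exists_tendsto_primalDual (E := Mat T) (S := LinearMap.toContinuousLinearMap S)
    (fun X Y => ?_) (fun X Y => ?_) hS (fun X => ?_) ha hd ha₀ hd₀
  · rw [norm_sq]; exact hp X Y
  · rw [norm_sq]; exact hq X Y
  · refine (sq_le_sq₀ (norm_nonneg _) (norm_nonneg _)).1 ?_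
    rw [norm_sq, norm_sq]; exact hS₁ X

/-! ### Proximal points -/

/-- The variational inequality that characterizes the proximal point `X` at `Y` of the convex
function that is `φ` on `C` and `+∞` elsewhere. -/
def IsProxVI (C : Set (Mat T)) (φ : Mat T → ℝ) (Y X : Mat T) : Prop :=
  X ∈ C ∧ ∀ Z ∈ C, φ X + frobInner (Y - X) (Z - X) ≤ φ Z

/-- Each inequality is tested at the other proximal point; the values of `φ` cancel in the sum. -/
theorem IsProxVI.firm {C : Set (Mat T)} {φ : Mat T → ℝ} {X Y X' Y' : Mat T}
    (h : IsProxVI C φ Y X) (h' : IsProxVI C φ Y' X') :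
    frobInner (X - X') (X - X') ≤ frobInner (X - X') (Y - Y') := by
  have h1 := h.2 X' h'.1
  have h2 := h'.2 X h.1
  simp only [frobInner_sub_left, frobInner_sub_right] at *
  have := frobInner_comm X Y
  have := frobInner_comm X Y'
  have := frobInner_comm X' Y
  have := frobInner_comm X' Y'
  linarith

theorem IsProxVI.unique {C : Set (Mat T)} {φ : Mat T → ℝ} {X X' Y : Mat T}
    (h : IsProxVI C φ Y X) (h' : IsProxVI C φ Y X') : X = X' := by
  have := h.firm h'
  rw [sub_self, frobInner_sub_right (X - X') X X', ← frobInner_sub_right] at this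
  refine sub_eq_zero.1 (eq_zero_of_frobInner_self_nonpos (this.trans (le_of_eq ?_)))
  simp [frobInner]

theorem le_of_forall_small_le {a b : ℝ} (hb : 0 ≤ b) (h : ∀ s : ℝ, 0 < s → s ≤ 1 → a ≤ s * b) :
    a ≤ 0 := by
  by_contra! ha
  have h1 := h (min 1 (a / (2 * (b + 1)))) (by positivity) (min_le_left _ _)
  have h2 : min 1 (a / (2 * (b + 1))) * b ≤ a / (2 * (b + 1)) * b :=
    mul_le_mul_of_nonneg_right (min_le_right _ _) hb
  have h3 : a / (2 * (b + 1)) * b < a := by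
    rw [div_mul_eq_mul_div, div_lt_iff₀ (by positivity)]
    nlinarith
  linarith

/-- Compare `X` with `(1 - s) X + s Z`, divide by `s`, and let the remainder `s/2 ‖Z - X‖²` go to
zero. -/
theorem isProxVI_of_isMinOn {C : Set (Mat T)} {φ : Mat T → ℝ} (hφ : ConvexOn ℝ C φ) {X Y : Mat T}
    (hX : X ∈ C)
    (hmin : IsMinOn (fun Z => φ Z + 1 / 2 * frobInner (Z - Y) (Z - Y)) C X) :
    IsProxVI C φ Y X := by
  refine ⟨hX, fun Z hZ => ?_⟩
  suffices φ X + frobInner (Y - X) (Z - X) - φ Z ≤ 0 by linarith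
  refine le_of_forall_small_le (b := 1 / 2 * frobInner (Z - X) (Z - X))
    (by linarith [frobInner_self_nonneg (Z - X)]) fun s hs hs1 => ?_
  have h1 := hφ.2 hX hZ (sub_nonneg.2 hs1) hs.le (by ring)
  have hmem := hφ.1 hX hZ (sub_nonneg.2 hs1) hs.le (by ring)
  have h2 := isMinOn_iff.1 hmin _ hmem
  have e : (1 - s) • X + s • Z - Y = (X - Y) + s • (Z - X) := by
    rw [sub_smul, one_smul, smul_sub]; abel
  have e2 : Y - X = -(X - Y) := by abel
  simp only [e, frobInner_add_left, frobInner_add_right, frobInner_smul_left,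
    frobInner_smul_right, smul_eq_mul] at h1 h2
  have h3 := frobInner_comm (Z - X) (X - Y)
  rw [e2, frobInner_neg_left]
  refine le_of_mul_le_mul_left ?_ hs
  rw [h3] at h2
  nlinarith

/-- `prox` is a mere choice, so a minimizer must be supplied through `hne` before anything is known
about it; finiteness of the minimum then forces the chosen point into `C`. -/
theorem isProxVI_prox {C : Set (Mat T)} {φ : Mat T → ℝ} (hφ : ConvexOn ℝ C φ)
    {h : Mat T → EReal} (hC : ∀ X ∈ C, h X = (φ X : EReal)) (hC' : ∀ X ∉ C, h X = ⊤) {Y : Mat T}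
    (hne : ∃ X ∈ C, IsMinOn (fun Z => φ Z + 1 / 2 * frobInner (Z - Y) (Z - Y)) C X) :
    IsProxVI C φ Y (prox h Y) := by
  have hval {X : Mat T} (hX : X ∈ C) :
      h X + ((1 / 2 * frobInner (X - Y) (X - Y) : ℝ) : EReal) =
        ((φ X + 1 / 2 * frobInner (X - Y) (X - Y) : ℝ) : EReal) := by
    rw [hC X hX, ← EReal.coe_add]
  have hspec : IsProxPoint h Y (prox h Y) := by
    refine Classical.epsilon_spec (p := IsProxPoint h Y) ?_
    obtain ⟨X, hX, hmin⟩ := hne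
    refine ⟨X, Set.mem_univ _, ?_, fun Z _ => ?_⟩
    · beta_reduce
      rw [hval hX]; exact EReal.coe_ne_top _
    · beta_reduce
      by_cases hZ : Z ∈ C
      · rw [hval hX, hval hZ]
        exact EReal.coe_le_coe_iff.2 (isMinOn_iff.1 hmin Z hZ)
      · rw [hC' Z hZ, EReal.top_add_coe]; exact le_top
  have hmem : prox h Y ∈ C := by
    by_contra hn
    refine hspec.2.1 ?_
    beta_reduce
    rw [hC' _ hn, EReal.top_add_coe]
  refine isProxVI_of_isMinOn hφ hmem (isMinOn_iff.2 fun Z hZ => ?_)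
  have := hspec.2.2 Z (Set.mem_univ _)
  beta_reduce at this
  rw [hval hmem, hval hZ] at this
  exact EReal.coe_le_coe_iff.1 this

/-- A function that is continuous on `C` and has a compact sublevel set attains its minimum. -/
theorem exists_isMinOn_of_compact {C K : Set (Mat T)} {F : Mat T → ℝ} (hF : ContinuousOn F C)
    (hK : IsCompact K) (hKC : K ⊆ C) {X₀ : Mat T} (hX₀ : X₀ ∈ C)
    (hsub : ∀ X ∈ C, F X ≤ F X₀ → X ∈ K) : ∃ X ∈ C, IsMinOn F C X := by
  obtain ⟨X, hX, hmin⟩ := hK.exists_isMinOn ⟨X₀, hsub X₀ hX₀ le_rfl⟩ (hF.mono hKC)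
  refine ⟨X, hKC hX, isMinOn_iff.2 fun Z hZ => ?_⟩
  rcases le_total (F Z) (F X₀) with h | h
  · exact isMinOn_iff.1 hmin Z (hsub Z hZ h)
  · exact (isMinOn_iff.1 hmin X₀ (hsub X₀ hX₀ le_rfl)).trans h

theorem isCompact_setOf_forall_abs_sub_le (Y : Mat T) (R : ℝ) :
    IsCompact {X : Mat T | ∀ i j, |X i j - Y i j| ≤ R} := by
  have h : IsCompact (Set.univ.pi fun i => Set.univ.pi fun j => Metric.closedBall (Y i j) R :
      Set (Fin T → Fin T → ℝ)) :=
    isCompact_univ_pi fun i => isCompact_univ_pi fun j => isCompact_closedBall _ _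
  have e : {X : Mat T | ∀ i j, |X i j - Y i j| ≤ R} =
      (Set.univ.pi fun i => Set.univ.pi fun j => Metric.closedBall (Y i j) R :
        Set (Fin T → Fin T → ℝ)) := by
    refine Set.ext fun X => ⟨fun hX i _ j _ => ?_, fun hX i j => ?_⟩
    · exact Metric.mem_closedBall.2 ((Real.dist_eq _ _).trans_le (hX i j))
    · exact (Real.dist_eq _ _).symm.trans_le (Metric.mem_closedBall.1 (hX i trivial j trivial))
  rw [e]
  exact h

theorem abs_apply_le_of_frobInner_le {X : Mat T} {r : ℝ} (h : 1 / 2 * frobInner X X ≤ r)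
    (i j : Fin T) : |X i j| ≤ r + 1 := by
  have h1 := sq_apply_le_frobInner X i j
  have h2 := frobInner_self_nonneg X
  refine abs_le_of_sq_le_sq ?_ (by linarith)
  -- `2 r ≤ (r + 1)²` avoids a square root.
  nlinarith [sq_nonneg r]

/-! ### The entrywise norm -/

theorem l1Norm_nonneg (X : Mat T) : 0 ≤ l1Norm X :=
  Finset.sum_nonneg fun _ _ => Finset.sum_nonneg fun _ _ => abs_nonneg _

theorem continuous_l1Norm : Continuous (l1Norm : Mat T → ℝ) := by
  unfold l1Norm
  fun_prop

theorem l1Norm_transpose (X : Mat T) : l1Norm Xᵀ = l1Norm X := by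
  simp only [l1Norm, transpose_apply]
  exact Finset.sum_comm

theorem convexOn_l1Norm : ConvexOn ℝ Set.univ (l1Norm : Mat T → ℝ) := by
  refine ⟨convex_univ, fun X _ Y _ a b ha hb _ => ?_⟩
  simp only [l1Norm, smul_eq_mul, Finset.mul_sum, ← Finset.sum_add_distrib]
  refine Finset.sum_le_sum fun i _ => Finset.sum_le_sum fun j _ => ?_
  refine (abs_add_le _ _).trans (le_of_eq ?_)
  simp [abs_mul, abs_of_nonneg ha, abs_of_nonneg hb]

theorem trace_le_l1Norm (X : Mat T) : X.trace ≤ l1Norm X :=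
  Finset.sum_le_sum fun i _ => (le_abs_self _).trans
    (Finset.single_le_sum (f := fun j => |X i j|) (fun _ _ => abs_nonneg _) (Finset.mem_univ i))

theorem isProxVI_prox_l1Norm {c : ℝ} (hc : 0 ≤ c) (Y : Mat T) :
    IsProxVI Set.univ (fun X => c * l1Norm X) Y
      (prox (fun X => ((c * l1Norm X : ℝ) : EReal)) Y) := by
  refine isProxVI_prox (convexOn_l1Norm.smul hc) (fun _ _ => rfl)
    (fun X hX => absurd (Set.mem_univ X) hX) ?_
  have hcont : Continuous fun Z : Mat T => c * l1Norm Z + 1 / 2 * frobInner (Z - Y) (Z - Y) := by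
    have := continuous_l1Norm (T := T)
    have := (continuous_frobInner (T := T)).comp
      (show Continuous fun Z : Mat T => (Z - Y, Z - Y) by fun_prop)
    simp only [Function.comp_def] at this
    fun_prop
  refine exists_isMinOn_of_compact hcont.continuousOn
    (isCompact_setOf_forall_abs_sub_le Y (c * l1Norm Y + 1)) (Set.subset_univ _)
    (Set.mem_univ Y) fun X _ hX i j => ?_
  have h0 : frobInner (Y - Y) (Y - Y) = 0 := by simp [frobInner]
  rw [h0] at hX
  simp only [smul_eq_mul] at hX
  exact abs_apply_le_of_frobInner_le (X := X - Y)
    (by linarith [mul_nonneg hc (l1Norm_nonneg X)]) i j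

/-! ### The trace of the inverse -/

theorem posDef_isSymm {X : Mat T} (hX : X.PosDef) : X.IsSymm := by
  have := hX.isHermitian
  rwa [IsHermitian, conjTranspose_eq_transpose_of_trivial] at this

theorem continuousOn_inv_posDef :
    ContinuousOn (fun X : Mat T => X⁻¹) {X : Mat T | X.PosDef} := fun X hX =>
  (continuousAt_matrix_inv X (by
    simpa using continuousAt_inv₀ hX.det_pos.ne')).continuousWithinAt

/-- The subgradient inequality for `X ↦ tr X⁻¹` on positive definite matrices. -/
theorem trace_inv_add_frobInner_le {X Z : Mat T} (hX : X.PosDef) (hZ : Z.PosDef) :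
    X⁻¹.trace + frobInner (-(X⁻¹ * X⁻¹)) (Z - X) ≤ Z⁻¹.trace := by
  have hXi : X⁻¹ᵀ = X⁻¹ := posDef_isSymm hX.inv
  have hZt : Zᵀ = Z := posDef_isSymm hZ
  have hXd : IsUnit X.det := (isUnit_iff_isUnit_det _).1 hX.isUnit
  have hZd : IsUnit Z.det := (isUnit_iff_isUnit_det _).1 hZ.isUnit
  -- The trace of this positive semidefinite matrix is exactly the gap between the two sides.
  have h := (hZ.inv.posSemidef.conjTranspose_mul_mul_same (Z * X⁻¹ - 1)).trace_nonneg
  have e : (Z * X⁻¹ - 1)ᴴ * Z⁻¹ * (Z * X⁻¹ - 1) = X⁻¹ * Z * X⁻¹ - X⁻¹ - X⁻¹ + Z⁻¹ := by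
    rw [conjTranspose_eq_transpose_of_trivial, transpose_sub, transpose_mul, hXi, hZt,
      transpose_one, Matrix.sub_mul, Matrix.mul_assoc, mul_nonsing_inv _ hZd, Matrix.mul_one,
      Matrix.one_mul, Matrix.mul_sub, Matrix.sub_mul, Matrix.mul_one,
      ← Matrix.mul_assoc Z⁻¹, nonsing_inv_mul _ hZd, Matrix.one_mul, ← Matrix.mul_assoc]
    abel
  have e2 : frobInner (-(X⁻¹ * X⁻¹)) (Z - X) = X⁻¹.trace - (X⁻¹ * Z * X⁻¹).trace := by
    rw [frobInner_neg_left, frobInner_eq_trace, transpose_mul, hXi, Matrix.mul_sub, trace_sub,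
      Matrix.mul_assoc X⁻¹ X⁻¹ X, nonsing_inv_mul _ hXd, Matrix.mul_one, Matrix.mul_assoc X⁻¹ Z,
      trace_mul_comm X⁻¹ (Z * X⁻¹), Matrix.mul_assoc X⁻¹ X⁻¹ Z, trace_mul_comm X⁻¹ (X⁻¹ * Z),
      Matrix.mul_assoc, trace_mul_comm X⁻¹ (Z * X⁻¹)]
    ring
  rw [e, trace_add, trace_sub, trace_sub] at h
  rw [e2]
  linarith

theorem convex_posDef : Convex ℝ {X : Mat T | X.PosDef} := by
  intro X hX Y hY a b ha hb hab
  rcases ha.eq_or_lt with rfl | ha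
  · rw [zero_add] at hab; subst hab; simpa using hY
  · exact PosDef.add_posSemidef (hX.smul ha) (hY.posSemidef.smul hb)

/-- Average the subgradient inequalities based at the convex combination `W`; the linear terms
cancel. -/
theorem convexOn_trace_inv :
    ConvexOn ℝ {X : Mat T | X.PosDef} fun X : Mat T => X⁻¹.trace := by
  refine ⟨convex_posDef, fun X hX Y hY a b ha hb hab => ?_⟩
  have hW := convex_posDef hX hY ha hb hab
  generalize hWd : a • X + b • Y = W at hW ⊢
  have h1 := mul_le_mul_of_nonneg_left (trace_inv_add_frobInner_le hW hX) ha
  have h2 := mul_le_mul_of_nonneg_left (trace_inv_add_frobInner_le hW hY) hb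
  have h3 : a * frobInner (-(W⁻¹ * W⁻¹)) (X - W) + b * frobInner (-(W⁻¹ * W⁻¹)) (Y - W) = 0 := by
    rw [← frobInner_smul_right, ← frobInner_smul_right, ← frobInner_add_right]
    have : a • (X - W) + b • (Y - W) = 0 := by
      rw [smul_sub, smul_sub, sub_add_sub_comm, hWd, ← add_smul, hab, one_smul, sub_self]
    rw [this]
    simp [frobInner]
  simp only [smul_eq_mul]
  have h4 : W⁻¹.trace = a * W⁻¹.trace + b * W⁻¹.trace := by rw [← add_mul, hab, one_mul]
  linarith

theorem trace_inv_nonneg {X : Mat T} (hX : X.PosDef) : 0 ≤ X⁻¹.trace :=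
  hX.inv.posSemidef.trace_nonneg

/-! ### Square roots of positive semidefinite matrices -/

section Sqrt

open scoped MatrixOrder

theorem exists_eq_transpose_mul_self {A : Mat T} (hA : A.PosSemidef) :
    ∃ C : Mat T, A = Cᵀ * C := by
  refine ⟨CFC.sqrt A, ?_⟩
  have h : (CFC.sqrt A)ᴴ = CFC.sqrt A := (CFC.sqrt_nonneg A).posSemidef.isHermitian
  rw [← conjTranspose_eq_transpose_of_trivial, h, CFC.sqrt_mul_sqrt_self A hA.nonneg]

theorem invSqrt_mul_self {Q : Mat T} (hQ : Q.PosDef) : invSqrt Q * invSqrt Q = Q⁻¹ :=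
  CFC.sqrt_mul_sqrt_self Q⁻¹ hQ.inv.posSemidef.nonneg

theorem posDef_invSqrt {Q : Mat T} (hQ : Q.PosDef) : (invSqrt Q).PosDef := by
  have h : (invSqrt Q).PosSemidef := (CFC.sqrt_nonneg Q⁻¹).posSemidef
  exact h.posDef_iff_isUnit.2
    (isUnit_of_mul_isUnit_right (y := invSqrt Q) (invSqrt_mul_self hQ ▸ hQ.inv.isUnit))

end Sqrt

/-! ### Attainment of minima on the open positive definite cone -/

theorem continuousOn_trace_inv :
    ContinuousOn (fun X : Mat T => X⁻¹.trace) {X : Mat T | X.PosDef} :=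
  (show Continuous fun X : Mat T => X.trace from continuous_id.matrix_trace).comp_continuousOn
    continuousOn_inv_posDef

theorem isClosed_setOf_posSemidef : IsClosed {X : Mat T | X.PosSemidef} := by
  simp only [posSemidef_iff_dotProduct_mulVec, IsHermitian, Set.ofPred_and, Set.ofPred_forall]
  refine (isClosed_eq continuous_id.matrix_conjTranspose continuous_id).inter
    (isClosed_iInter fun v => isClosed_le continuous_const ?_)
  exact continuous_const.dotProduct (continuous_id.matrix_mulVec continuous_const)

/-- Every eigenvalue of `X⁻¹` is at most its trace, so `det X⁻¹ ≤ c ^ T`. This is a closed condition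
that keeps sublevel sets away from the boundary of the cone. -/
theorem one_le_det_mul {X : Mat T} (hX : X.PosDef) {c : ℝ} (hc : X⁻¹.trace ≤ c) :
    1 ≤ X.det * c ^ T := by
  have h1 : X⁻¹.det ≤ c ^ T := by
    have hi := hX.inv
    have hH := hi.isHermitian
    have hdet : X⁻¹.det = ∏ i, hH.eigenvalues i := by
      simpa using hH.det_eq_prod_eigenvalues
    have htr : X⁻¹.trace = ∑ i, hH.eigenvalues i := by
      simpa using hH.trace_eq_sum_eigenvalues
    have hle (i : Fin T) : hH.eigenvalues i ≤ c := by
      refine le_trans ?_ hc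
      rw [htr]
      exact Finset.single_le_sum (fun i _ => hi.posSemidef.eigenvalues_nonneg i)
        (Finset.mem_univ i)
    rw [hdet]
    simpa using Finset.prod_le_prod (s := Finset.univ)
      (fun i _ => hi.posSemidef.eigenvalues_nonneg i) fun i _ => hle i
  have h2 : X.det * X⁻¹.det = 1 := by
    rw [← det_mul, mul_nonsing_inv _ ((isUnit_iff_isUnit_det _).1 hX.isUnit), det_one]
  rw [← h2]
  exact mul_le_mul_of_nonneg_left h1 hX.det_pos.le

/-- The cone is open, but positive semidefiniteness and `1 ≤ det X * c` are closed and together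
imply definiteness; intersected with a box they give a compact set inside the cone. -/
theorem exists_isMinOn_posDef {F : Mat T → ℝ} (hF : ContinuousOn F {X : Mat T | X.PosDef})
    (Y : Mat T) (R c : ℝ) (hR : ∀ X : Mat T, X.PosDef → F X ≤ F 1 →
      1 ≤ X.det * c ∧ ∀ i j, |X i j - Y i j| ≤ R) :
    ∃ X : Mat T, X.PosDef ∧ IsMinOn F {X : Mat T | X.PosDef} X := by
  have hK : IsCompact ({X : Mat T | ∀ i j, |X i j - Y i j| ≤ R} ∩
      ({X : Mat T | X.PosSemidef} ∩ {X : Mat T | 1 ≤ X.det * c})) :=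
    (isCompact_setOf_forall_abs_sub_le Y R).inter_right (isClosed_setOf_posSemidef.inter
      (isClosed_le continuous_const (continuous_id.matrix_det.mul continuous_const)))
  refine exists_isMinOn_of_compact hF hK ?_ (X₀ := 1) PosDef.one fun X hX h => ?_
  · rintro X ⟨-, hX, hdet⟩
    refine hX.posDef_iff_det_ne_zero.2 fun h0 => ?_
    rw [Set.mem_ofPred_eq, h0] at hdet
    linarith
  · exact ⟨(hR X hX h).2, PosDef.posSemidef hX, (hR X hX h).1⟩

theorem isProxVI_prox_H₂ {σ : ℝ} (hσ : 0 < σ) (Y : Mat T) :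
    IsProxVI {X : Mat T | X.PosDef} (fun X => σ * X⁻¹.trace) Y
      (prox (fun X => (σ : EReal) * H₂ X) Y) := by
  refine isProxVI_prox (convexOn_trace_inv.smul hσ.le) (fun X hX => ?_) (fun X hX => ?_) ?_
  · rw [H₂, if_pos (show X.PosDef from hX), ← EReal.coe_mul, smul_eq_mul]
  · rw [H₂, if_neg (show ¬X.PosDef from hX), EReal.coe_mul_top_of_pos hσ]
  simp only [smul_eq_mul]
  have hcont : ContinuousOn (fun Z : Mat T => σ * Z⁻¹.trace + 1 / 2 * frobInner (Z - Y) (Z - Y))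
      {X : Mat T | X.PosDef} := by
    have := (continuous_frobInner (T := T)).comp
      (show Continuous fun Z : Mat T => (Z - Y, Z - Y) by fun_prop)
    exact (continuousOn_trace_inv.const_mul σ).add (this.const_mul _).continuousOn
  generalize hF : (fun Z : Mat T => σ * Z⁻¹.trace + 1 / 2 * frobInner (Z - Y) (Z - Y)) = F
    at hcont ⊢
  refine exists_isMinOn_posDef hcont Y (F 1 + 1) ((F 1 / σ) ^ T) fun X hX h => ?_
  have hX' : σ * X⁻¹.trace + 1 / 2 * frobInner (X - Y) (X - Y) ≤ F 1 := by rwa [← hF] at h ⊢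
  have h1 := frobInner_self_nonneg (X - Y)
  have h2 := mul_nonneg hσ.le (trace_inv_nonneg hX)
  refine ⟨one_le_det_mul hX ?_, fun i j => ?_⟩
  · rw [le_div_iff₀ hσ]; linarith
  · exact abs_apply_le_of_frobInner_le (X := X - Y) (by linarith) i j

/-- Testing with `e_i ± e_j` gives `2 |X i j| ≤ X i i + X j j`. -/
theorem abs_apply_le_trace {X : Mat T} (hX : X.PosSemidef) (i j : Fin T) : |X i j| ≤ X.trace := by
  have hs : X j i = X i j := by simpa using hX.isHermitian.apply i j
  have hd (k : Fin T) : X k k ≤ X.trace :=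
    Finset.single_le_sum (f := fun k => X k k) (fun k _ => hX.diag_nonneg) (Finset.mem_univ k)
  have h1 := hX.dotProduct_mulVec_nonneg (Pi.single i 1 + Pi.single j 1)
  have h2 := hX.dotProduct_mulVec_nonneg (Pi.single i 1 - Pi.single j 1)
  simp [mulVec_add, mulVec_sub, add_dotProduct, sub_dotProduct] at h1 h2
  rw [abs_le]
  constructor <;> linarith [hd i, hd j]

/-- Congruence by `C`, where `A = Cᵀ C`, reduces to `A = 1`, where `s ‖N‖ < 1` is enough. It makes
every symmetric direction admissible at an interior minimizer. -/
theorem exists_posDef_add_smul {A H : Mat T} (hA : A.PosDef) (hH : H.IsSymm) :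
    ∃ s₀ > 0, ∀ s : ℝ, 0 < s → s < s₀ → (A + s • H).PosDef := by
  obtain ⟨C, hC, rfl⟩ : ∃ C : Mat T, IsUnit C ∧ A = Cᵀ * C := by
    obtain ⟨C, hC⟩ := exists_eq_transpose_mul_self hA.posSemidef
    exact ⟨C, isUnit_of_mul_isUnit_right (hC ▸ hA.isUnit), hC⟩
  have hCd := (isUnit_iff_isUnit_det _).1 hC
  obtain ⟨N, hN, rfl⟩ : ∃ N : Mat T, N.IsSymm ∧ H = Cᵀ * N * C := by
    refine ⟨C⁻¹ᵀ * H * C⁻¹, ?_, ?_⟩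
    · simp [IsSymm, transpose_mul, hH.eq, Matrix.mul_assoc]
    · have : Cᵀ * (C⁻¹)ᵀ = 1 := by rw [← transpose_mul, nonsing_inv_mul _ hCd, transpose_one]
      rw [← Matrix.mul_assoc, ← Matrix.mul_assoc, this, Matrix.one_mul, Matrix.mul_assoc,
        nonsing_inv_mul _ hCd, Matrix.mul_one]
  have hb : ∀ v, |v ⬝ᵥ N *ᵥ v| ≤ ‖toEuclideanCLM (n := Fin T) (𝕜 := ℝ) N‖ * (v ⬝ᵥ v) := by
    intro v
    have h1 := inner_toEuclideanCLM N (WithLp.toLp 2 v) (WithLp.toLp 2 v)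
    have h2 := abs_real_inner_le_norm (WithLp.toLp 2 v)
      (toEuclideanCLM (n := Fin T) (𝕜 := ℝ) N (WithLp.toLp 2 v))
    have h3 := (toEuclideanCLM (n := Fin T) (𝕜 := ℝ) N).le_opNorm (WithLp.toLp 2 v)
    have h4 : v ⬝ᵥ v = ‖WithLp.toLp 2 v‖ ^ 2 := by
      rw [EuclideanSpace.real_norm_sq_eq]; simp [dotProduct, sq]
    rw [h1] at h2
    rw [h4]
    nlinarith [norm_nonneg (WithLp.toLp 2 v)]
  set b := ‖toEuclideanCLM (n := Fin T) (𝕜 := ℝ) N‖ with hb'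
  have hb0 : 0 ≤ b := norm_nonneg _
  refine ⟨1 / (b + 1), by positivity, fun s hs hs' => ?_⟩
  have hsb : s * (b + 1) < 1 := by rwa [lt_div_iff₀ (by positivity)] at hs'
  have hpd : (1 + s • N).PosDef := by
    refine PosDef.of_dotProduct_mulVec_pos ?_ fun v hv => ?_
    · simp [IsHermitian, conjTranspose_eq_transpose_of_trivial, hN.eq]
    · have h0 : 0 < v ⬝ᵥ v := by simpa using dotProduct_star_self_pos_iff.2 hv
      have := neg_abs_le (v ⬝ᵥ N *ᵥ v)
      simp only [star_trivial, add_mulVec, one_mulVec, smul_mulVec, dotProduct_add,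
        dotProduct_smul, smul_eq_mul]
      nlinarith [hb v]
  have e : Cᵀ * C + s • (Cᵀ * N * C) = Cᴴ * (1 + s • N) * C := by
    simp [Matrix.mul_add, Matrix.add_mul]
  rw [e]
  exact hpd.conjTranspose_mul_mul_same (mulVec_injective_of_isUnit hC)

/-! ### Saddle points -/

/-- The regularizer `μ tr(A) + (1 - μ) ‖A‖_{ℓ₁}`. -/
def sparseReg (μ : ℝ) (A : Mat T) : ℝ := μ * A.trace + (1 - μ) * l1Norm A

theorem continuous_sparseReg (μ : ℝ) : Continuous (sparseReg μ : Mat T → ℝ) := by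
  have := continuous_l1Norm (T := T)
  have : Continuous fun X : Mat T => X.trace := continuous_id.matrix_trace
  unfold sparseReg
  fun_prop

theorem convexOn_sparseReg {μ : ℝ} (hμ : μ ≤ 1) :
    ConvexOn ℝ Set.univ (sparseReg μ : Mat T → ℝ) := by
  refine ConvexOn.add ?_ (convexOn_l1Norm.smul (sub_nonneg.2 hμ))
  refine ⟨convex_univ, fun X _ Y _ a b _ _ _ => le_of_eq ?_⟩
  simp only [trace_add, trace_smul, smul_eq_mul]
  ring

theorem sparseReg_transpose (μ : ℝ) (X : Mat T) : sparseReg μ Xᵀ = sparseReg μ X := by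
  rw [sparseReg, trace_transpose, l1Norm_transpose, sparseReg]

/-- Coercivity on the cone, uniform in `μ`, so the endpoints 0 and 1 need no separate treatment. -/
theorem trace_le_sparseReg {μ : ℝ} (hμ : μ ≤ 1) (X : Mat T) : X.trace ≤ sparseReg μ X := by
  have := mul_le_mul_of_nonneg_left (trace_le_l1Norm X) (sub_nonneg.2 hμ)
  rw [sparseReg]
  linarith

/-- The optimality conditions `-L D ∈ ∂(G + H₁)(A)` and `D ∈ ∂H₂(L A)`. -/
structure IsSaddle (M : Mat T) (μ : ℝ) (A D : Mat T) : Prop where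
  reg : ∀ Z, sparseReg μ A - frobInner (L M D) (Z - A) ≤ sparseReg μ Z
  posDef : (L M A).PosDef
  inv : ∀ Z : Mat T, Z.PosDef → (L M A)⁻¹.trace + frobInner D (Z - L M A) ≤ Z⁻¹.trace

theorem L_posDef_iff {M : Mat T} (hM : M.PosDef) {X : Mat T} : (L M X).PosDef ↔ X.PosDef := by
  have h : star M = M := hM.isHermitian
  have := hM.isUnit.posDef_star_left_conjugate_iff (x := X)
  rwa [h] at this

theorem exists_isMinOn_primal {M : Mat T} (hM : M.PosDef) {μ : ℝ} (hμ : μ ≤ 1) :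
    ∃ A : Mat T, A.PosDef ∧
      IsMinOn (fun X => sparseReg μ X + (L M X)⁻¹.trace) {X : Mat T | X.PosDef} A := by
  have hcont : ContinuousOn (fun X => sparseReg μ X + (L M X)⁻¹.trace) {X : Mat T | X.PosDef} :=
    (continuous_sparseReg μ).continuousOn.add
      (continuousOn_trace_inv.comp (continuous_L M).continuousOn fun X hX => (L_posDef_iff hM).2 hX)
  generalize hF : (fun X : Mat T => sparseReg μ X + (L M X)⁻¹.trace) = F at hcont ⊢
  -- `F 1` bounds both `tr X` and `tr((L X)⁻¹)` on the sublevel set; `M.det ^ 2` comes from `det (L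
  -- X)`.
  refine exists_isMinOn_posDef hcont 0 (F 1) (M.det ^ 2 * F 1 ^ T) fun X hX h => ?_
  have hX' : sparseReg μ X + (L M X)⁻¹.trace ≤ F 1 := by rwa [← hF] at h ⊢
  have hL := (L_posDef_iff hM).2 hX
  have h1 := trace_inv_nonneg hL
  have h2 := trace_le_sparseReg hμ X
  have h3 := hX.posSemidef.trace_nonneg
  constructor
  · have := one_le_det_mul hL (c := F 1) (by linarith)
    rw [L, det_mul, det_mul] at this
    linarith
  · intro i j
    rw [Matrix.zero_apply, sub_zero]
    linarith [abs_apply_le_trace hX.posSemidef i j]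

/-- First-order condition at `A`. The subgradient inequality is used at the moved point `A + s (X -
A)`, which gives the right sign; after division by `s`, continuity of the inverse moves the gradient
back to `A` as `s → 0`. -/
theorem sparseReg_le_of_isMinOn {M : Mat T} (hM : M.PosDef) {μ : ℝ} (hμ : μ ≤ 1) {A : Mat T}
    (hA : A.PosDef)
    (hmin : IsMinOn (fun X => sparseReg μ X + (L M X)⁻¹.trace) {X : Mat T | X.PosDef} A)
    {X : Mat T} (hX : X.IsSymm) :
    sparseReg μ A - frobInner (L M (-((L M A)⁻¹ * (L M A)⁻¹))) (X - A) ≤ sparseReg μ X := by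
  have hMs := posDef_isSymm hM
  have hH : (X - A).IsSymm := hX.sub (posDef_isSymm hA)
  obtain ⟨s₀, hs₀, hpd⟩ := exists_posDef_add_smul hA hH
  have key : ∀ s : ℝ, 0 < s → s < s₀ → s < 1 →
      sparseReg μ A + frobInner ((L M (A + s • (X - A)))⁻¹ * (L M (A + s • (X - A)))⁻¹)
        (L M (X - A)) ≤ sparseReg μ X := by
    intro s hs hs' hs1
    have hp := hpd s hs hs'
    have h1 := isMinOn_iff.1 hmin _ hp
    have h2 := trace_inv_add_frobInner_le ((L_posDef_iff hM).2 hp) ((L_posDef_iff hM).2 hA)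
    have h3 := (convexOn_sparseReg (T := T) hμ).2 (Set.mem_univ A) (Set.mem_univ X)
      (sub_nonneg.2 hs1.le) hs.le (by ring)
    have e : (1 - s) • A + s • X = A + s • (X - A) := by
      rw [sub_smul, one_smul, smul_sub]; abel
    have e2 : L M A - L M (A + s • (X - A)) = -(s • L M (X - A)) := by
      rw [L_add, L_smul]; abel
    rw [e2, frobInner_neg_left, frobInner_neg_right, frobInner_smul_right] at h2
    rw [e] at h3
    simp only [smul_eq_mul] at h3
    refine le_of_mul_le_mul_left ?_ hs
    linarith
  have hlim : Tendsto (fun s : ℝ => sparseReg μ A +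
      frobInner ((L M (A + s • (X - A)))⁻¹ * (L M (A + s • (X - A)))⁻¹) (L M (X - A)))
      (𝓝[>] 0) (𝓝 (sparseReg μ A + frobInner ((L M A)⁻¹ * (L M A)⁻¹) (L M (X - A)))) := by
    have hL := (L_posDef_iff hM).2 hA
    have c1 : Tendsto (fun s : ℝ => L M (A + s • (X - A))) (𝓝[>] 0) (𝓝 (L M A)) := by
      have : Continuous fun s : ℝ => L M (A + s • (X - A)) :=
        (continuous_L M).comp (by fun_prop)
      have := this.tendsto 0
      rw [zero_smul, add_zero] at this
      exact this.mono_left nhdsWithin_le_nhds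
    have c2 : Tendsto (fun Y : Mat T => Y⁻¹) (𝓝 (L M A)) (𝓝 (L M A)⁻¹) :=
      continuousAt_matrix_inv (L M A) (by simpa using continuousAt_inv₀ hL.det_pos.ne')
    have c3 := c2.comp c1
    have c4 := (continuous_frobInner.tendsto _).comp
      ((c3.mul c3).prodMk_nhds (tendsto_const_nhds (x := L M (X - A))))
    exact c4.const_add _
  have hle := le_of_tendsto hlim (b := sparseReg μ X) (by
    filter_upwards [Ioo_mem_nhdsGT (lt_min hs₀ one_pos)] with s hs
    exact key s hs.1 (hs.2.trans_le (min_le_left _ _)) (hs.2.trans_le (min_le_right _ _)))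
  rw [frobInner_L_left hMs, frobInner_neg_left]
  linarith

/-- The dual variable is the gradient of `H₂` at `L A`. Minimality only tests symmetric directions;
a general `Z` is replaced by its symmetrization, which does not increase the convex,
transpose-invariant regularizer and pairs equally with a symmetric matrix. -/
theorem exists_isSaddle {M : Mat T} (hM : M.PosDef) {μ : ℝ} (hμ : μ ≤ 1) :
    ∃ A D, IsSaddle M μ A D ∧ D.IsSymm := by
  obtain ⟨A, hA, hmin⟩ := exists_isMinOn_primal hM hμ
  have hL := (L_posDef_iff hM).2 hA
  have hDs : (-((L M A)⁻¹ * (L M A)⁻¹)).IsSymm := by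
    rw [IsSymm, transpose_neg, transpose_mul, posDef_isSymm hL.inv]
  refine ⟨A, -((L M A)⁻¹ * (L M A)⁻¹), ⟨fun Z => ?_, hL,
    fun Z hZ => trace_inv_add_frobInner_le hL hZ⟩, hDs⟩
  have hLD := L_isSymm (posDef_isSymm hM) hDs
  generalize hE : L M (-((L M A)⁻¹ * (L M A)⁻¹)) = E at hLD
  have hS : ((1 / 2 : ℝ) • Z + (1 / 2 : ℝ) • Zᵀ).IsSymm := by
    simp [IsSymm, add_comm]
  have h1 := sparseReg_le_of_isMinOn hM hμ hA hmin hS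
  have h2 := (convexOn_sparseReg (T := T) hμ).2 (Set.mem_univ Z) (Set.mem_univ Zᵀ)
    (by norm_num : (0 : ℝ) ≤ 1 / 2) (by norm_num : (0 : ℝ) ≤ 1 / 2) (by norm_num)
  rw [sparseReg_transpose] at h2
  have h3 : frobInner E Zᵀ = frobInner E Z := by
    rw [← frobInner_transpose, hLD.eq, transpose_transpose]
  rw [hE, frobInner_sub_right, frobInner_add_right, frobInner_smul_right, frobInner_smul_right,
    h3] at h1
  rw [frobInner_sub_right]
  simp only [smul_eq_mul] at h2
  linarith

namespace IsSaddle

variable {M A D : Mat T} {μ : ℝ}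

theorem posDef_primal (h : IsSaddle M μ A D) (hM : M.PosDef) : A.PosDef :=
  (L_posDef_iff hM).1 h.posDef

theorem primal_le (h : IsSaddle M μ A D) (hM : M.PosDef) {X : Mat T} (hX : X.PosDef) :
    sparseReg μ A + (L M A)⁻¹.trace ≤ sparseReg μ X + (L M X)⁻¹.trace := by
  have h1 := h.reg X
  have h2 := h.inv _ ((L_posDef_iff hM).2 hX)
  rw [← L_sub, ← frobInner_L_left (posDef_isSymm hM)] at h2
  linarith

/-- Fenchel-Young equality: the subgradient condition says that the supremum is attained at `A`. -/
theorem fenchelConj_reg (h : IsSaddle M μ A D) :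
    fenchelConj (GH₁ μ) (-(L M D)) = ((-frobInner A (L M D) - sparseReg μ A : ℝ) : EReal) := by
  refine le_antisymm (iSup_le fun X => ?_) (le_iSup_of_le A (le_of_eq ?_))
  · rw [GH₁, ← EReal.coe_sub, EReal.coe_le_coe_iff]
    have := h.reg X
    rw [frobInner_comm, frobInner_sub_left] at this
    rw [frobInner_neg_right]
    rw [sparseReg, sparseReg] at *
    linarith
  · rw [GH₁, ← EReal.coe_sub, frobInner_neg_right, sparseReg]

theorem fenchelConj_H₂ (h : IsSaddle M μ A D) :
    fenchelConj H₂ D = ((frobInner (L M A) D - (L M A)⁻¹.trace : ℝ) : EReal) := by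
  refine le_antisymm (iSup_le fun X => ?_) (le_iSup_of_le (L M A) (le_of_eq ?_))
  · by_cases hX : X.PosDef
    · rw [H₂, if_pos hX, ← EReal.coe_sub, EReal.coe_le_coe_iff]
      have := h.inv X hX
      rw [frobInner_comm, frobInner_sub_left] at this
      linarith
    · rw [H₂, if_neg hX, sub_eq_add_neg, EReal.neg_top, EReal.add_bot]
      exact bot_le
  · rw [H₂, if_pos h.posDef, ← EReal.coe_sub]

/-- Weak duality shows that the dual variable of a saddle point solves the dual problem. -/
theorem isGlobalMinimizer_dual (h : IsSaddle M μ A D) (hM : M.PosDef) :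
    IsGlobalMinimizer (fun E => fenchelConj (GH₁ μ) (-(L M E)) + fenchelConj H₂ E) Set.univ D := by
  have hval : fenchelConj (GH₁ μ) (-(L M D)) + fenchelConj H₂ D =
      ((-sparseReg μ A - (L M A)⁻¹.trace : ℝ) : EReal) := by
    rw [h.fenchelConj_reg, h.fenchelConj_H₂, ← EReal.coe_add, frobInner_L_left (posDef_isSymm hM)]
    congr 1
    ring
  refine ⟨Set.mem_univ _, ?_, fun E _ => ?_⟩ <;> beta_reduce <;> rw [hval]
  · exact EReal.coe_ne_top _
  · have h1 : ((-frobInner A (L M E) - sparseReg μ A : ℝ) : EReal) ≤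
        fenchelConj (GH₁ μ) (-(L M E)) :=
      le_iSup_of_le A (le_of_eq (by rw [GH₁, ← EReal.coe_sub, frobInner_neg_right, sparseReg]))
    have h2 : ((frobInner (L M A) E - (L M A)⁻¹.trace : ℝ) : EReal) ≤ fenchelConj H₂ E :=
      le_iSup_of_le (L M A) (le_of_eq (by rw [H₂, if_pos h.posDef, ← EReal.coe_sub]))
    refine le_trans (le_of_eq ?_) (add_le_add h1 h2)
    rw [← EReal.coe_add, frobInner_L_left (posDef_isSymm hM)]
    congr 1
    ring

end IsSaddle

/-! ### Convergence of the iteration -/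

/-- The primal map `U ↦ prox_{((1-μ)/σ) ‖·‖_{ℓ₁}} (U - (μ/σ) I)`. -/
def primalMap (μ σ : ℝ) (U : Mat T) : Mat T :=
  prox (fun X => (((1 - μ) / σ * l1Norm X : ℝ) : EReal)) (U - (1 / σ) • μ • (1 : Mat T))

/-- The dual map `P ↦ P - (1/σ) prox_{σ H₂} (σ P)`. -/
def dualMap (σ : ℝ) (P : Mat T) : Mat T :=
  P - (1 / σ) • prox (fun X => (σ : EReal) * H₂ X) (σ • P)

theorem primalMap_firm {μ σ : ℝ} (hμ : μ ≤ 1) (hσ : 0 < σ) (X Y : Mat T) :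
    frobInner (primalMap μ σ X - primalMap μ σ Y) (primalMap μ σ X - primalMap μ σ Y) ≤
      frobInner (primalMap μ σ X - primalMap μ σ Y) (X - Y) := by
  have hc : 0 ≤ (1 - μ) / σ := div_nonneg (sub_nonneg.2 hμ) hσ.le
  have := (isProxVI_prox_l1Norm hc (X - (1 / σ) • μ • (1 : Mat T))).firm
    (isProxVI_prox_l1Norm hc (Y - (1 / σ) • μ • (1 : Mat T)))
  rwa [sub_sub_sub_cancel_right] at this

/-- Moreau's decomposition: `P ↦ (1/σ) prox_{σ H₂}(σ P)` is firmly nonexpansive, and so is its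
complement to the identity. -/
theorem dualMap_firm {σ : ℝ} (hσ : 0 < σ) (X Y : Mat T) :
    frobInner (dualMap σ X - dualMap σ Y) (dualMap σ X - dualMap σ Y) ≤
      frobInner (dualMap σ X - dualMap σ Y) (X - Y) := by
  have h := (isProxVI_prox_H₂ hσ (σ • X)).firm (isProxVI_prox_H₂ hσ (σ • Y))
  simp only [dualMap]
  generalize prox (fun X => (σ : EReal) * H₂ X) (σ • X) = U at *
  generalize prox (fun X => (σ : EReal) * H₂ X) (σ • Y) = V at *
  have e : X - (1 / σ) • U - (Y - (1 / σ) • V) = (X - Y) - (1 / σ) • (U - V) := by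
    rw [smul_sub]; abel
  rw [← smul_sub, frobInner_smul_right] at h
  rw [e]
  generalize X - Y = Z at *
  generalize U - V = W at *
  simp only [frobInner_sub_left, frobInner_sub_right, frobInner_smul_left, frobInner_smul_right]
  rw [frobInner_comm Z W]
  have h2 : 1 / σ * (1 / σ * frobInner W W) ≤ 1 / σ * frobInner W Z := by
    refine mul_le_mul_of_nonneg_left ?_ (by positivity)
    rw [one_div, inv_mul_le_iff₀ hσ]
    exact h
  linarith

/-- For symmetric input, the transpose of the proximal point satisfies the same variational
inequality, so uniqueness applies. -/
theorem isSymm_primalMap {μ σ : ℝ} (hμ : μ ≤ 1) (hσ : 0 < σ) {U : Mat T} (hU : U.IsSymm) :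
    (primalMap μ σ U).IsSymm := by
  have hc : 0 ≤ (1 - μ) / σ := div_nonneg (sub_nonneg.2 hμ) hσ.le
  have h := isProxVI_prox_l1Norm hc (U - (1 / σ) • μ • (1 : Mat T))
  have hY : (U - (1 / σ) • μ • (1 : Mat T)).IsSymm := by simp [IsSymm, hU.eq]
  rw [IsSymm, primalMap]
  generalize U - (1 / σ) • μ • (1 : Mat T) = Y at *
  generalize prox (fun X => (((1 - μ) / σ * l1Norm X : ℝ) : EReal)) Y = X at *
  refine IsProxVI.unique (Y := Y) ⟨Set.mem_univ _, fun Z _ => ?_⟩ h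
  have := h.2 Zᵀ (Set.mem_univ _)
  rw [← frobInner_transpose, transpose_sub, transpose_sub, transpose_transpose,
    hY.eq] at this
  beta_reduce at this ⊢
  rw [l1Norm_transpose] at this
  rwa [l1Norm_transpose]

theorem isSymm_dualMap {σ : ℝ} (hσ : 0 < σ) {P : Mat T} (hP : P.IsSymm) :
    (dualMap σ P).IsSymm :=
  hP.sub ((posDef_isSymm (isProxVI_prox_H₂ hσ (σ • P)).1).smul _)

/-- The fixed point equations say that `A` and `L A` are proximal points; their variational
inequalities are, up to the factor `σ`, the two subgradient conditions. -/
theorem isSaddle_iff_fixedPoint {M A D : Mat T} {μ σ : ℝ} (hμ : μ ≤ 1) (hσ : 0 < σ) :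
    IsSaddle M μ A D ↔ A = primalMap μ σ (A - (1 / σ) • L M D) ∧
      D = dualMap σ (D + (1 / σ) • L M A) := by
  have hc : 0 ≤ (1 - μ) / σ := div_nonneg (sub_nonneg.2 hμ) hσ.le
  have h1 := isProxVI_prox_l1Norm hc (A - (1 / σ) • L M D - (1 / σ) • μ • (1 : Mat T))
  have h2 := isProxVI_prox_H₂ hσ (σ • (D + (1 / σ) • L M A))
  have e1 (Z : Mat T) : σ * frobInner (A - (1 / σ) • L M D - (1 / σ) • μ • (1 : Mat T) - A) (Z - A) =
      -frobInner (L M D) (Z - A) - μ * (Z.trace - A.trace) := by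
    have e : A - (1 / σ) • L M D - (1 / σ) • μ • (1 : Mat T) - A =
        -((1 / σ) • (L M D + μ • (1 : Mat T))) := by rw [smul_add]; abel
    have e' : frobInner 1 (Z - A) = Z.trace - A.trace := by
      rw [frobInner_eq_trace, transpose_one, Matrix.one_mul, trace_sub]
    rw [e, frobInner_neg_left, frobInner_smul_left, frobInner_add_left, frobInner_smul_left, e']
    field_simp
    ring
  have e2 (Z : Mat T) : frobInner (σ • (D + (1 / σ) • L M A) - L M A) (Z - L M A) =
      σ * frobInner D (Z - L M A) := by
    have e : σ • (D + (1 / σ) • L M A) - L M A = σ • D := by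
      rw [smul_add, smul_smul, mul_one_div_cancel hσ.ne', one_smul, add_sub_cancel_right]
    rw [e, frobInner_smul_left]
  have e3 (Z : Mat T) : σ * ((1 - μ) / σ * l1Norm Z) = (1 - μ) * l1Norm Z := by
    field_simp
  have v1 (Z : Mat T) : sparseReg μ A - frobInner (L M D) (Z - A) ≤ sparseReg μ Z ↔
      (1 - μ) / σ * l1Norm A +
        frobInner (A - (1 / σ) • L M D - (1 / σ) • μ • (1 : Mat T) - A) (Z - A) ≤
      (1 - μ) / σ * l1Norm Z := by
    rw [iff_comm, ← mul_le_mul_iff_right₀ hσ, mul_add, e1, e3, e3, sparseReg, sparseReg]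
    constructor <;> intro h <;> linarith
  have v2 (Z : Mat T) : (L M A)⁻¹.trace + frobInner D (Z - L M A) ≤ Z⁻¹.trace ↔
      σ * (L M A)⁻¹.trace + frobInner (σ • (D + (1 / σ) • L M A) - L M A) (Z - L M A) ≤
        σ * Z⁻¹.trace := by
    rw [e2, ← mul_add, mul_le_mul_iff_right₀ hσ]
  -- `D` cancels from the dual equation, leaving `L A` as the proximal point.
  have d (U : Mat T) : D = D + (1 / σ) • L M A - (1 / σ) • U ↔ L M A = U := by
    rw [add_sub_assoc, left_eq_add, ← smul_sub, smul_eq_zero_iff_right (by positivity), sub_eq_zero]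
  rw [dualMap, d, primalMap]
  constructor
  · intro h
    exact ⟨IsProxVI.unique ⟨Set.mem_univ _, fun Z _ => (v1 Z).1 (h.reg Z)⟩ h1,
      IsProxVI.unique ⟨h.posDef, fun Z hZ => (v2 Z).1 (h.inv Z hZ)⟩ h2⟩
  · rintro ⟨hA, hD⟩
    rw [← hA] at h1
    rw [← hD] at h2
    exact ⟨fun Z => (v1 Z).2 (h1.2 Z (Set.mem_univ _)), h2.1, fun Z hZ => (v2 Z).2 (h2.2 Z hZ)⟩

/-- The scaled operator `(1/σ) L`. -/
def scaledL (M : Mat T) (σ : ℝ) : Mat T →ₗ[ℝ] Mat T where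
  toFun X := (1 / σ) • L M X
  map_add' X Y := by rw [L_add, smul_add]
  map_smul' c X := by rw [L_smul, smul_comm, RingHom.id_apply]

theorem step_eq {n : ℕ} (K : Matrix (Fin n) (Fin n) ℝ) (B : Matrix (Fin n) (Fin T) ℝ) (ε μ : ℝ)
    {M : Mat T} (hM : invSqrt (taskCov K B ε) = M) {σ : ℝ} (hσ : specNormSq M = σ) (A D A' D' : Mat T)
    (h : (A', D') = step K B ε μ (A, D)) :
    A' = primalMap μ σ (A - scaledL M σ D) ∧
      D' = dualMap σ (D + scaledL M σ ((2 : ℝ) • A' - A)) := by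
  simp only [step, hM, hσ, Prod.mk.injEq] at h
  have hA : A' = primalMap μ σ (A - scaledL M σ D) := by
    rw [h.1, primalMap]
    congr 1
    rw [smul_add, add_comm, ← sub_sub]
    rfl
  refine ⟨hA, ?_⟩
  rw [← h.1] at h
  exact h.2

theorem exists_tendsto_isSaddle {n : ℕ} (K : Matrix (Fin n) (Fin n) ℝ)
    (B : Matrix (Fin n) (Fin T) ℝ) {ε μ : ℝ} (hμ : μ ≤ 1) (hQ : (taskCov K B ε).PosDef)
    {A D : ℕ → Mat T} (hA₀ : (A 0).IsSymm) (hD₀ : (D 0).IsSymm)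
    (hstep : ∀ i, (A (i + 1), D (i + 1)) = step K B ε μ (A i, D i)) :
    ∃ A' D', Tendsto A atTop (𝓝 A') ∧ Tendsto D atTop (𝓝 D') ∧ D'.IsSymm ∧
      IsSaddle (invSqrt (taskCov K B ε)) μ A' D' := by
  have hM := posDef_invSqrt hQ
  generalize hMd : invSqrt (taskCov K B ε) = M at hM ⊢
  obtain ⟨a, d, hsad, hd⟩ := exists_isSaddle hM hμ
  -- For `T = 0` one has `σ = 0`, but there is only one matrix.
  rcases isEmpty_or_nonempty (Fin T) with hT | hT
  · exact ⟨a, d, tendsto_const_nhds.congr fun _ => Subsingleton.elim _ _,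
      tendsto_const_nhds.congr fun _ => Subsingleton.elim _ _, hd, hsad⟩
  have hMs := posDef_isSymm hM
  have hσ := specNormSq_pos hM.isUnit
  have hnorm := frobInner_L_self_le hMs
  generalize hσd : specNormSq M = σ at hσ hnorm
  have hit := fun i => step_eq K B ε μ hMd hσd _ _ _ _ (hstep i)
  have hsad' := (isSaddle_iff_fixedPoint hμ hσ).1 hsad
  obtain ⟨A', D', hA', hD', fA, fD⟩ := exists_tendsto_primalDual_frobInner
    (primalMap_firm hμ hσ) (dualMap_firm hσ) (scaledL M σ)
    (fun X Y => by
      change frobInner ((1 / σ) • L M X) Y = frobInner X ((1 / σ) • L M Y)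
      rw [frobInner_smul_left, frobInner_smul_right, frobInner_L_left hMs])
    (fun X => by
      change frobInner ((1 / σ) • L M X) ((1 / σ) • L M X) ≤ _
      rw [frobInner_smul_left, frobInner_smul_right, ← mul_assoc, ← sq, one_div, inv_pow,
        inv_mul_le_iff₀ (by positivity)]
      exact hnorm X)
    (fun i => (hit i).1) (fun i => (hit i).2) hsad'.1 hsad'.2
  -- `IsSaddle` does not force `D'` to be symmetric; this is inherited from the iterates.
  have hsymm : ∀ i, (A i).IsSymm ∧ (D i).IsSymm := by
    intro i
    induction i with
    | zero => exact ⟨hA₀, hD₀⟩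
    | succ i ih =>
      have hS {X : Mat T} (hX : X.IsSymm) : (scaledL M σ X).IsSymm := (L_isSymm hMs hX).smul _
      have h1 : (A (i + 1)).IsSymm := by
        rw [(hit i).1]
        exact isSymm_primalMap hμ hσ (ih.1.sub (hS ih.2))
      refine ⟨h1, ?_⟩
      rw [(hit i).2]
      exact isSymm_dualMap hσ (ih.2.add (hS ((h1.smul _).sub ih.1)))
  refine ⟨A', D', hA', hD', ?_, (isSaddle_iff_fixedPoint hμ hσ).2 ⟨fA, fD⟩⟩
  have ht : Tendsto (fun i => (D i)ᵀ) atTop (𝓝 D'ᵀ) :=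
    ((continuous_id.matrix_transpose).tendsto D').comp hD'
  exact tendsto_nhds_unique (ht.congr fun i => (hsymm i).2) hD'

/-! ### Matrices built from the data -/

theorem posSemidef_empirical {𝒳 : Type*} {n : ℕ} {k : 𝒳 → 𝒳 → ℝ} (hk : (Matrix.of k).PosSemidef)
    {x : Fin n → 𝒳} {K : Matrix (Fin n) (Fin n) ℝ} (hK : ∀ i j, K i j = k (x i) (x j)) :
    K.PosSemidef := by
  have h := hk.submatrix x
  rwa [show (Matrix.of k).submatrix x x = K from Matrix.ext fun i j => (hK i j).symm] at h

theorem posDef_taskCov {n : ℕ} {K : Matrix (Fin n) (Fin n) ℝ} (hK : K.PosSemidef)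
    (B : Matrix (Fin n) (Fin T) ℝ) {ε : ℝ} (hε : 0 < ε) : (taskCov K B ε).PosDef := by
  have h := hK.conjTranspose_mul_mul_same B
  rw [conjTranspose_eq_transpose_of_trivial] at h
  exact PosDef.posSemidef_add h (PosDef.one.smul hε)

theorem trace_inv_L_invSqrt {Q : Mat T} (hQ : Q.PosDef) (A : Mat T) :
    (L (invSqrt Q) A)⁻¹.trace = (A⁻¹ * Q).trace := by
  have h : (invSqrt Q)⁻¹ * (invSqrt Q)⁻¹ = Q := by
    rw [← Matrix.mul_inv_rev, invSqrt_mul_self hQ,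
      nonsing_inv_nonsing_inv _ ((isUnit_iff_isUnit_det _).1 hQ.isUnit)]
  rw [L, Matrix.mul_inv_rev, Matrix.mul_inv_rev, trace_mul_comm, Matrix.mul_assoc, h]

/-! ### The reproducing kernel Hilbert space of a separable kernel -/

/-- With `A = Cᵀ C`, the quadratic form of `k A` is the sum over `t` of scalar forms of `k` with
coefficients `(C w) t`. -/
theorem posSemidef_sepKernel {𝒳 : Type*} {k : 𝒳 → 𝒳 → ℝ} (hk : (Matrix.of k).PosSemidef)
    {A : Mat T} (hA : A.PosSemidef) : (sepKernel k A).PosSemidef := by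
  have hks (z w : 𝒳) : k z w = k w z := by simpa using hk.isHermitian.apply w z
  obtain ⟨C, rfl⟩ := exists_eq_transpose_mul_self hA
  have hstar : star (toEuclideanCLM (n := Fin T) (𝕜 := ℝ) (Cᵀ * C)) =
      toEuclideanCLM (n := Fin T) (𝕜 := ℝ) (Cᵀ * C) := by
    rw [← map_star, star_eq_conjTranspose, conjTranspose_eq_transpose_of_trivial, transpose_mul,
      transpose_transpose]
  have tf := (RKHS.posSemidef_tfae (K := sepKernel k (Cᵀ * C))).out 0 2
  refine tf.2 ⟨?_, fun v => ?_⟩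
  · ext1 z w
    simp only [conjTranspose_apply, sepKernel, of_apply, star_smul, hstar, star_trivial]
    rw [hks]
  · have hin (u u' : Vec T) :
        inner ℝ (toEuclideanCLM (n := Fin T) (𝕜 := ℝ) (Cᵀ * C) u) u' =
          ∑ t, (C *ᵥ u.ofLp) t * (C *ᵥ u'.ofLp) t := by
      rw [real_inner_comm, inner_toEuclideanCLM, ← mulVec_mulVec, dotProduct_mulVec,
        vecMul_transpose, dotProduct_comm]
      rfl
    have hpos (t : Fin T) : 0 ≤ v.sum fun z w => v.sum fun z' w' =>
        (C *ᵥ w.ofLp) t * k z z' * (C *ᵥ w'.ofLp) t := by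
      have := hk.2 (v.mapRange (fun w => (C *ᵥ w.ofLp) t) (by simp))
      simpa [Finsupp.sum_mapRange_index] using this
    have e : (v.sum fun z w => v.sum fun z' w' => inner ℝ (sepKernel k (Cᵀ * C) z' z w) w') =
        ∑ t, v.sum fun z w => v.sum fun z' w' =>
          (C *ᵥ w.ofLp) t * k z z' * (C *ᵥ w'.ofLp) t := by
      simp only [Finsupp.sum, sepKernel, of_apply, _root_.smul_apply,
        real_inner_smul_left, hin]
      symm
      rw [Finset.sum_comm]
      refine Finset.sum_congr rfl fun z _ => ?_
      rw [Finset.sum_comm]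
      refine Finset.sum_congr rfl fun z' _ => ?_
      rw [Finset.mul_sum, hks]
      exact Finset.sum_congr rfl fun t _ => by ring
    simp only [RCLike.re_to_real]
    rw [e]
    exact Finset.sum_nonneg fun t _ => hpos t

/-- `f` is the sum of kernel sections at `x i` with coefficients `A⁻¹ b i`, so the reproducing
property evaluates its norm. -/
theorem rkhsNormSq_sepKernel {𝒳 : Type*} {n : ℕ} {k : 𝒳 → 𝒳 → ℝ} (hk : (Matrix.of k).PosSemidef)
    {x : Fin n → 𝒳} {b : Fin n → Vec T} {f : 𝒳 → Vec T} (hf : ∀ z, f z = ∑ i, k z (x i) • b i)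
    {K : Matrix (Fin n) (Fin n) ℝ} (hK : ∀ i j, K i j = k (x i) (x j))
    {B : Matrix (Fin n) (Fin T) ℝ} (hB : ∀ i t, B i t = b i t) {A : Mat T} (hA : A.PosDef) :
    rkhsNormSq (sepKernel k A) f = (((A⁻¹ * (Bᵀ * K * B)).trace : ℝ) : EReal) := by
  have hΓ := posSemidef_sepKernel hk hA.posSemidef
  have hAd : IsUnit A.det := (isUnit_iff_isUnit_det _).1 hA.isUnit
  rw [rkhsNormSq, dif_pos hΓ]
  have : Fact (sepKernel k A).PosSemidef := ⟨hΓ⟩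
  let Ai := toEuclideanCLM (n := Fin T) (𝕜 := ℝ) A⁻¹
  let g : RKHS.OfKernel (sepKernel k A) :=
    ∑ i, RKHS.kerFun (RKHS.OfKernel (sepKernel k A)) (x i) (Ai (b i))
  have hg : (g : 𝒳 → Vec T) = f := by
    funext z
    have h1 : g z = ∑ i, RKHS.kerFun (RKHS.OfKernel (sepKernel k A)) (x i) (Ai (b i)) z := by
      rw [← RKHS.coeCLM_apply, map_sum, Finset.sum_apply]
      rfl
    rw [h1, hf]
    refine Finset.sum_congr rfl fun i _ => ?_
    have h2 : toEuclideanCLM (n := Fin T) (𝕜 := ℝ) A (Ai (b i)) = b i := by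
      change (toEuclideanCLM (n := Fin T) (𝕜 := ℝ) A *
        toEuclideanCLM (n := Fin T) (𝕜 := ℝ) A⁻¹) (b i) = b i
      rw [← map_mul, mul_nonsing_inv _ hAd, map_one]
      rfl
    rw [RKHS.kerFun_apply, RKHS.OfKernel.kernel_ofKernel, sepKernel, of_apply,
      _root_.smul_apply, h2]
  have hnorm : ‖g‖ ^ 2 = (A⁻¹ * (Bᵀ * K * B)).trace := by
    have h1 : ‖g‖ ^ 2 = ∑ i, inner ℝ (Ai (b i)) (f (x i)) := by
      rw [← real_inner_self_eq_norm_sq]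
      conv_lhs => enter [2]; unfold g
      rw [sum_inner]
      refine Finset.sum_congr rfl fun i _ => ?_
      rw [RKHS.kerFun_inner, hg]
    have h2 (i j : Fin n) : inner ℝ (Ai (b i)) (b j) = (B * A⁻¹ * Bᵀ) j i := by
      have hBr (i : Fin n) : (b i).ofLp = B i := funext fun t => (hB i t).symm
      rw [real_inner_comm, inner_toEuclideanCLM, hBr, hBr, Matrix.mul_assoc]
      rfl
    have h3 : (A⁻¹ * (Bᵀ * K * B)).trace = (K * (B * A⁻¹ * Bᵀ)).trace := by
      rw [trace_mul_comm, Matrix.mul_assoc, trace_mul_comm, ← Matrix.mul_assoc, trace_mul_comm]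
    rw [h1, h3, trace]
    refine Finset.sum_congr rfl fun i _ => ?_
    rw [diag_apply, mul_apply, hf, inner_sum]
    refine Finset.sum_congr rfl fun j _ => ?_
    rw [real_inner_smul_right, h2, hK]
  -- An element of the space is determined by its values, so the infimum runs over `g` alone.
  refine le_antisymm (iInf₂_le_of_le g hg (by rw [hnorm])) (le_iInf₂ fun g' hg' => ?_)
  rw [show g' = g from DFunLike.coe_injective (hg'.trans hg.symm), hnorm]

/-! ### Return to the structure and joint objectives -/

theorem structureObjective_eq {n : ℕ} {K : Matrix (Fin n) (Fin n) ℝ}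
    {B : Matrix (Fin n) (Fin T) ℝ} {ε : ℝ} (hQ : (taskCov K B ε).PosDef) (μ : ℝ) (A : Mat T) :
    structureObjective K B ε μ A =
      ((sparseReg μ A + (L (invSqrt (taskCov K B ε)) A)⁻¹.trace : ℝ) : EReal) := by
  rw [structureObjective, trace_inv_L_invSqrt hQ, sparseReg]
  congr 1
  ring

theorem isGlobalMinimizer_structure {n : ℕ} {K : Matrix (Fin n) (Fin n) ℝ}
    {B : Matrix (Fin n) (Fin T) ℝ} {ε μ : ℝ} (hQ : (taskCov K B ε).PosDef) {A D : Mat T}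
    (h : IsSaddle (invSqrt (taskCov K B ε)) μ A D) :
    IsGlobalMinimizer (structureObjective K B ε μ) {X : Mat T | X.PosDef} A := by
  refine ⟨h.posDef_primal (posDef_invSqrt hQ), EReal.coe_ne_top _, fun X hX => ?_⟩
  rw [structureObjective_eq hQ, structureObjective_eq hQ]
  exact EReal.coe_le_coe_iff.2 (h.primal_le (posDef_invSqrt hQ) hX)

/-- For a fixed function, the joint objective is an increasing affine function of the structure
objective. -/
theorem jointObjective_eq {𝒳 : Type*} {n : ℕ} {k : 𝒳 → 𝒳 → ℝ} (hk : (Matrix.of k).PosSemidef)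
    {x : Fin n → 𝒳} {b : Fin n → Vec T} {f : 𝒳 → Vec T} (hf : ∀ z, f z = ∑ i, k z (x i) • b i)
    {K : Matrix (Fin n) (Fin n) ℝ} (hK : ∀ i j, K i j = k (x i) (x j))
    {B : Matrix (Fin n) (Fin T) ℝ} (hB : ∀ i t, B i t = b i t) {𝒴 : Set (Vec T)}
    (y : Fin n → 𝒴) (V : 𝒴 → Vec T → ℝ) (lam ε μ : ℝ) {A : Mat T} (hA : A.PosDef) :
    jointObjective k V lam ε μ x y f A =
      ((1 / (n : ℝ) * ∑ i, V (y i) (f (x i)) : ℝ) : EReal) +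
        (lam : EReal) * structureObjective K B ε μ A := by
  rw [jointObjective, rkhsNormSq_sepKernel hk hf hK hB hA, structureObjective, ← EReal.coe_add]
  congr 3
  rw [taskCov, Matrix.mul_add, trace_add, Matrix.mul_smul, trace_smul, Matrix.mul_one, smul_eq_mul]
  ring

end SKMTL

end

theorem mainTheorem2 {𝒳 : Type*} {n T : ℕ}
    -- a scalar kernel, points, and a function given by coefficient vectors
    (k : 𝒳 → 𝒳 → ℝ) (hk : (Matrix.of k).PosSemidef)
    (x : Fin n → 𝒳) (b : Fin n → SKMTL.Vec T)
    (f : 𝒳 → SKMTL.Vec T) (hf : ∀ z, f z = ∑ i, k z (x i) • b i)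
    -- the empirical kernel matrix and the coefficient matrix
    (K : Matrix (Fin n) (Fin n) ℝ) (hK : ∀ i j, K i j = k (x i) (x j))
    (B : Matrix (Fin n) (Fin T) ℝ) (hB : ∀ i t, B i t = b i t)
    -- outputs, convex loss, hyperparameters
    {𝒴 : Set (SKMTL.Vec T)} (y : Fin n → 𝒴) (V : 𝒴 → SKMTL.Vec T → ℝ)
    (hV₀ : ∀ u v, 0 ≤ V u v) (hV : ∀ u, ConvexOn ℝ Set.univ (V u))
    (lam ε μ : ℝ) (hlam : 0 < lam) (hε : 0 < ε) (hμ₀ : 0 ≤ μ) (hμ₁ : μ ≤ 1)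
    -- sequences produced by the algorithm
    (A D : ℕ → SKMTL.Mat T) (hA₀ : (A 0).PosDef) (hD₀ : (D 0).PosDef)
    (hstep : ∀ i, (A (i + 1), D (i + 1)) = SKMTL.step K B ε μ (A i, D i)) :
    (∃ A' : SKMTL.Mat T, Tendsto A atTop (𝓝 A') ∧
      SKMTL.IsGlobalMinimizer (SKMTL.jointObjective k V lam ε μ x y f)
        {X : SKMTL.Mat T | X.PosDef} A' ∧
      SKMTL.IsGlobalMinimizer (SKMTL.structureObjective K B ε μ)
        {X : SKMTL.Mat T | X.PosDef} A') ∧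
    (∃ D' : SKMTL.Mat T, Tendsto D atTop (𝓝 D') ∧ D'.IsSymm ∧
      SKMTL.IsGlobalMinimizer (SKMTL.dualObjective K B ε μ) Set.univ D') := by
  have hQ := SKMTL.posDef_taskCov (SKMTL.posSemidef_empirical hk hK) B hε
  obtain ⟨A', D', hA, hD, hDs, hsad⟩ := SKMTL.exists_tendsto_isSaddle K B hμ₁ hQ
    (SKMTL.posDef_isSymm hA₀) (SKMTL.posDef_isSymm hD₀) hstep
  have hmin := SKMTL.isGlobalMinimizer_structure hQ hsad
  refine ⟨⟨A', hA, ⟨hmin.1, ?_, fun X hX => ?_⟩, hmin⟩, D', hD, hDs,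
    hsad.isGlobalMinimizer_dual (SKMTL.posDef_invSqrt hQ)⟩
  · rw [SKMTL.jointObjective_eq hk hf hK hB y V lam ε μ hmin.1, SKMTL.structureObjective,
      ← EReal.coe_mul, ← EReal.coe_add]
    exact EReal.coe_ne_top _
  · rw [SKMTL.jointObjective_eq hk hf hK hB y V lam ε μ hmin.1,
      SKMTL.jointObjective_eq hk hf hK hB y V lam ε μ hX]
    gcongr
    exact hmin.2.2 X hX
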